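/- Let $S^1=\mathbb R/\mathbb Z$ with normalized Lebesgue measure and $\|h\|_1=\int_{S^1}|h|$. Let $f:S^1\to S^1$ be a smooth expanding map, i.e. $f$ is $C^\infty$ and $|f'(x)|>1$ for all $x\in S^1$. Then $f$ has a unique (up to null sets) invariant probability density $\rho_0$, and there is an integer $N\ge 1$ such that the following holds for every probability density $g$ on $\mathbb R$ (for instance $g=\tfrac12\mathbf 1_{[-1,1]}$). For each $\varepsilon>0$ the Markov chain $$x_{k+1}=f^N(x_k)+\varepsilon\xi_k \pmod 1,$$ where $f^N=f\circ\cdots\circ f$ ($N$ times) and the $\xi_k$ are i.i.d. with density $g$, $\xi_k$ being independent of $x_k$, has a unique (up to null sets) invariant probability density $\rho^{(N)}_\varepsilon$. Moreover, there are constants $c_1,c_2>0$, independent of $\varepsilon$, such that for all $\varepsilon>0$ $$c_1\,\|\rho^{(N)}_\varepsilon-\rho_0\|_1\;\le\;\|G_\varepsilon\rho_0-\rho_0\|_1\;\le\;c_2\,\|\rho^{(N)}_\varepsilon-\rho_0\|_1 ,$$ where $(G_\varepsilon q)(x)=\varepsilon^{-1}\int_{\mathbb R} g\!\left(\frac{x-y}{\varepsilon}\right)q(y)\,dy$,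 with $q$ regarded as a $1$-periodic function on $\mathbb R$. -/

import Mathlib

open MeasureTheory
open scoped ContDiff

noncomputable section

/-- A smooth expanding map of the circle `S¹ = ℝ/ℤ`: it has a `C^∞` lift `F : ℝ → ℝ` whose
derivative has absolute value `> 1` everywhere. -/
def IsSmoothExpanding (f : UnitAddCircle → UnitAddCircle) : Prop :=
  ∃ F : ℝ → ℝ, ContDiff ℝ ∞ F ∧
    (∀ x : ℝ, f (x : UnitAddCircle) = (F x : UnitAddCircle)) ∧
    ∀ x : ℝ, 1 < |deriv F x|

/-- A probability density with respect to the reference (Lebesgue) measure. -/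
structure IsProbDensity {X : Type*} [MeasureSpace X] (ρ : X → ℝ) : Prop where
  integrable : Integrable ρ
  nonneg : ∀ᵐ x, 0 ≤ ρ x
  integral_eq_one : ∫ x, ρ x = 1

/-- The measure `ρ(x) dx`. -/
def densityMeasure {X : Type*} [MeasureSpace X] (ρ : X → ℝ) : Measure X :=
  volume.withDensity fun x => ENNReal.ofReal (ρ x)

/-- `ρ` is an invariant probability density of the map `f`, i.e. of `x_{k+1} = f(x_k)`. -/
def IsInvariantDensity (f : UnitAddCircle → UnitAddCircle) (ρ : UnitAddCircle → ℝ) : Prop :=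
  IsProbDensity ρ ∧ (densityMeasure ρ).map f = densityMeasure ρ

/-- `ρ` is an invariant probability density of the Markov chain `x_{k+1} = f(x_k) + ε ξ_k`
(mod 1), where `ξ_k` is independent of `x_k` and has density `g`: if `x_k` has density `ρ`,
then so does `x_{k+1}`. -/
def IsNoisyInvariantDensity (f : UnitAddCircle → UnitAddCircle) (g : ℝ → ℝ) (ε : ℝ)
    (ρ : UnitAddCircle → ℝ) : Prop :=
  IsProbDensity ρ ∧
    ((densityMeasure ρ).prod (densityMeasure g)).map
      (fun p : UnitAddCircle × ℝ => f p.1 + ((ε * p.2 : ℝ) : UnitAddCircle)) = densityMeasure ρ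

/-- The averaging operator `(G_ε q)(x) = ε⁻¹ ∫ g((x - y)/ε) q(y) dy`. Noise is added modulo 1,
so `y` runs over `ℝ` and `q` is viewed as a 1-periodic function; here `s = x - y`. -/
def averagingOp (g : ℝ → ℝ) (ε : ℝ) (q : UnitAddCircle → ℝ) (x : UnitAddCircle) : ℝ :=
  ε⁻¹ * ∫ s : ℝ, g (s / ε) * q (x - (s : UnitAddCircle))

/-- The `L¹` norm `∫ |h|` on the circle. -/
def oneNorm (h : UnitAddCircle → ℝ) : ℝ := ∫ x, |h x|

end

noncomputable section

/-- The inverse `H` of a lift of an expanding circle map `f`, with its first four derivatives and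
the uniform bounds they satisfy. -/
structure InverseLift (f : UnitAddCircle → UnitAddCircle) where
  D : ℕ
  sgn : ℝ
  sgn_cases : sgn = 1 ∨ sgn = -1
  H : ℝ → ℝ
  H₁ : ℝ → ℝ
  H₂ : ℝ → ℝ
  H₃ : ℝ → ℝ
  H₄ : ℝ → ℝ
  hasDerivAt_H : ∀ y, HasDerivAt H (H₁ y) y
  hasDerivAt_H₁ : ∀ y, HasDerivAt H₁ (H₂ y) y
  hasDerivAt_H₂ : ∀ y, HasDerivAt H₂ (H₃ y) y
  hasDerivAt_H₃ : ∀ y, HasDerivAt H₃ (H₄ y) y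
  map_H : ∀ y : ℝ, f (H y : UnitAddCircle) = (y : UnitAddCircle)
  H_add : ∀ y, H (y + D) = H y + sgn
  H₁_add : ∀ y, H₁ (y + D) = H₁ y
  H₁_pos : ∀ y, 0 < sgn * H₁ y
  rate : ℝ
  rate_lt_one : rate < 1
  H₁_le : ∀ y, sgn * H₁ y ≤ rate
  bound : ℝ
  H₂_le : ∀ y, |H₂ y| ≤ bound * (sgn * H₁ y)
  H₃_le : ∀ y, |H₃ y| ≤ bound * (sgn * H₁ y)
  H₄_le : ∀ y, |H₄ y| ≤ bound * (sgn * H₁ y)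
  continuous_map : Continuous f

theorem surjective_of_one_le_deriv {F : ℝ → ℝ} (hF : Differentiable ℝ F)
    (h : ∀ x, 1 ≤ deriv F x) : Function.Surjective F := by
  have hm : Monotone (fun x => F x - x) := by
    apply monotone_of_deriv_nonneg (by fun_prop)
    intro x
    rw [((hF x).hasDerivAt.fun_sub (hasDerivAt_id' x)).deriv]
    linarith [h x]
  apply hF.continuous.surjective
  · refine Filter.tendsto_atTop_mono' _ ?_
      (Filter.tendsto_atTop_add_const_left _ (F 0) Filter.tendsto_id)
    filter_upwards [Filter.eventually_ge_atTop 0] with x hx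
    have := hm hx
    simp at this ⊢; linarith
  · refine Filter.tendsto_atBot_mono' _ ?_
      (Filter.tendsto_atBot_add_const_left _ (F 0) Filter.tendsto_id)
    filter_upwards [Filter.eventually_le_atBot 0] with x hx
    have := hm hx
    simp at this ⊢; linarith

theorem exists_lift_add_one {f : UnitAddCircle → UnitAddCircle} {F : ℝ → ℝ} (hF : Continuous F)
    (h : ∀ x : ℝ, f (x : UnitAddCircle) = (F x : UnitAddCircle)) :
    ∃ m : ℤ, ∀ x, F (x + 1) = F x + m := by
  have h1 : ∀ x, ∃ m : ℤ, F (x + 1) - F x = m := by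
    intro x
    have : ((F (x + 1) : ℝ) : UnitAddCircle) = (F x : UnitAddCircle) := by
      rw [← h, ← h]; simp
    rw [← sub_eq_zero, ← AddCircle.coe_sub, AddCircle.coe_eq_zero_iff] at this
    obtain ⟨n, hn⟩ := this
    exact ⟨n, by rw [← hn]; simp⟩
  choose m hm using h1
  have hc : Continuous m := by
    rw [Int.isClosedEmbedding_coe_real.isEmbedding.continuous_iff]
    have : ((fun n : ℤ => (n : ℝ)) ∘ m) = fun x => F (x + 1) - F x := by
      ext x; simp [hm x]
    rw [this]; fun_prop
  refine ⟨m 0, fun x => ?_⟩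
  have := PreconnectedSpace.constant (inferInstance : PreconnectedSpace ℝ) hc (x := x) (y := 0)
  linarith [hm x, congrArg (fun n : ℤ => (n : ℝ)) this]

theorem exists_bound_of_periodic {g : ℝ → ℝ} {T : ℝ} (hT : T ≠ 0) (hg : Continuous g)
    (hp : Function.Periodic g T) : ∃ x, ∀ y, g y ≤ g x := by
  obtain ⟨z, ⟨x, rfl⟩, hx⟩ := (hp.compact_of_continuous hT hg).exists_isGreatest
    (Set.range_nonempty g)
  exact ⟨x, fun y => hx ⟨y, rfl⟩⟩

theorem exists_inverse_of_one_lt_abs_deriv {F : ℝ → ℝ} (hF : ContDiff ℝ ∞ F)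
    (h : ∀ x, 1 < |deriv F x|) :
    ∃ (s : ℝ) (H : ℝ → ℝ), (s = 1 ∨ s = -1) ∧ ContDiff ℝ ∞ H ∧ (∀ y, F (H y) = y) ∧
      (∀ x, H (F x) = x) ∧ (∀ x, 1 < s * deriv F x) := by
  have hd : Differentiable ℝ F := hF.differentiable (by simp)
  have hdc : Continuous (deriv F) := hF.continuous_deriv (by simp)
  obtain ⟨s, hs, hpos⟩ : ∃ s : ℝ, (s = 1 ∨ s = -1) ∧ ∀ x, 1 < s * deriv F x := by
    by_cases h0 : 0 < deriv F 0
    · refine ⟨1, Or.inl rfl, fun x => ?_⟩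
      have hx := h x
      by_cases hx0 : 0 < deriv F x
      · rwa [abs_of_pos hx0, ← one_mul (deriv F x)] at hx
      · exfalso
        obtain ⟨y, hy⟩ := mem_range_of_exists_le_of_exists_ge hdc ⟨x, not_lt.mp hx0⟩ ⟨0, h0.le⟩
        have := h y
        rw [hy] at this; norm_num at this
    · refine ⟨-1, Or.inr rfl, fun x => ?_⟩
      have hx := h x
      by_cases hx0 : 0 < deriv F x
      · exfalso
        obtain ⟨y, hy⟩ := mem_range_of_exists_le_of_exists_ge hdc ⟨0, not_lt.mp h0⟩ ⟨x, hx0.le⟩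
        have := h y
        rw [hy] at this; norm_num at this
      · rw [abs_of_nonpos (not_lt.mp hx0)] at hx; linarith
  have hs2 : s * s = 1 := by rcases hs with rfl | rfl <;> norm_num
  have hd' : ∀ x, HasDerivAt (fun x => s * F x) (s * deriv F x) x :=
    fun x => (hd x).hasDerivAt.const_mul s
  have hmono : StrictMono fun x => s * F x :=
    strictMono_of_deriv_pos fun x => by rw [(hd' x).deriv]; linarith [hpos x]
  have hsurj : Function.Surjective fun x => s * F x :=
    surjective_of_one_le_deriv (fun x => (hd' x).differentiableAt)
      fun x => by rw [(hd' x).deriv]; exact (hpos x).le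
  let e : ℝ ≃ₜ ℝ := (hmono.orderIsoOfSurjective _ hsurj).toHomeomorph
  have he : ∀ x, e x = s * F x := fun x => rfl
  have hsm : ContDiff ℝ ∞ (e.symm : ℝ → ℝ) :=
    e.contDiff_symm_deriv (f' := fun x => s * deriv F x) (fun x => by linarith [hpos x])
      hd' (contDiff_const.mul hF)
  refine ⟨s, fun y => e.symm (s * y), hs, hsm.comp (contDiff_const.mul contDiff_id), ?_, ?_, hpos⟩
  · intro y
    have h1 := he (e.symm (s * y))
    rw [e.apply_symm_apply] at h1
    calc F (e.symm (s * y)) = s * s * F (e.symm (s * y)) := by rw [hs2, one_mul]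
      _ = s * (s * y) := by rw [mul_assoc, ← h1]
      _ = y := by rw [← mul_assoc, hs2, one_mul]
  · intro x
    simp only [← he, e.symm_apply_apply]

theorem Function.Periodic.deriv_periodic {g : ℝ → ℝ} {T : ℝ} (hp : Function.Periodic g T) :
    Function.Periodic (deriv g) T := by
  intro x
  rw [← deriv_comp_add_const]
  exact congrArg (fun k => deriv k x) (funext hp)

theorem exists_abs_le_mul_of_periodic {g w : ℝ → ℝ} {T : ℝ} (hT : T ≠ 0) (hg : Continuous g)
    (hw : Continuous w) (hwpos : ∀ y, 0 < w y) (hgp : Function.Periodic g T)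
    (hwp : Function.Periodic w T) : ∃ C, ∀ y, |g y| ≤ C * w y := by
  obtain ⟨x, hx⟩ := exists_bound_of_periodic (g := fun y => |g y| / w y) hT
    (hg.abs.div hw fun y => (hwpos y).ne') (fun y => by simp only [hgp y, hwp y])
  exact ⟨|g x| / w x, fun y => (div_le_iff₀ (hwpos y)).1 (hx y)⟩

theorem IsSmoothExpanding.nonempty_inverseLift {f : UnitAddCircle → UnitAddCircle}
    (hf : IsSmoothExpanding f) : Nonempty (InverseLift f) := by
  obtain ⟨F, hF, hlift, hexp⟩ := hf
  obtain ⟨s, H, hs, hH, hFH, hHF, hpos⟩ := exists_inverse_of_one_lt_abs_deriv hF hexp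
  obtain ⟨m, hm⟩ := exists_lift_add_one hF.continuous hlift
  have hs2 : s * s = 1 := by rcases hs with rfl | rfl <;> norm_num
  have hFd : Differentiable ℝ F := hF.differentiable (by simp)
  have hHm : ∀ y, H (y + m) = H y + 1 := by
    intro y
    conv_lhs => rw [← hFH y, ← hm, hHF]
  have hsm : 0 < s * m := by
    have hmono : StrictMono fun x => s * F x :=
      strictMono_of_deriv_pos fun x => by
        rw [((hFd x).hasDerivAt.const_mul s).deriv]; linarith [hpos x]
    have := hmono (zero_lt_one (α := ℝ))
    have h1 := hm 0
    simp only [zero_add] at h1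
    simp only [h1] at this
    linarith
  obtain ⟨D, hD⟩ : ∃ D : ℕ, (D : ℝ) = s * m := by
    rcases hs with rfl | rfl
    · refine ⟨m.toNat, ?_⟩
      have : 0 < m := by exact_mod_cast (by linarith : (0:ℝ) < m)
      rw [one_mul]; exact_mod_cast Int.toNat_of_nonneg this.le
    · refine ⟨(-m).toNat, ?_⟩
      have : 0 < -m := by exact_mod_cast (by push_cast; linarith : (0:ℝ) < ((-m : ℤ) : ℝ))
      have h2 := Int.toNat_of_nonneg this.le
      have h3 : (((-m).toNat : ℤ) : ℝ) = ((-m : ℤ) : ℝ) := by rw [h2]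
      push_cast at h3 ⊢; linarith
  have hDpos : (0 : ℝ) < D := by rw [hD]; exact hsm
  have hHD : ∀ y, H (y + D) = H y + s := by
    intro y
    rw [hD]
    rcases hs with rfl | rfl
    · simpa using hHm y
    · have := hHm (y + -1 * m)
      rw [show y + -1 * (m : ℝ) + m = y by ring] at this
      linarith
  have hsmooth : ∀ n, ContDiff ℝ ∞ (deriv^[n] H) := fun n => by
    induction n with
    | zero => exact hH
    | succ n ih =>
      rw [Function.iterate_succ_apply']
      exact ((contDiff_infty_iff_deriv (𝕜 := ℝ)).1 ih).2
  have hder : ∀ n y, HasDerivAt (deriv^[n] H) (deriv^[n+1] H y) y := fun n y => by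
    rw [Function.iterate_succ_apply']
    exact ((hsmooth n).differentiable (by simp) y).hasDerivAt
  have hper : ∀ n, Function.Periodic (deriv^[n+1] H) D := fun n => by
    induction n with
    | zero =>
      intro y
      change deriv H (y + D) = deriv H y
      rw [← deriv_comp_add_const, ← deriv_add_const s (f := H)]
      exact congrArg (fun k => deriv k y) (funext hHD)
    | succ n ih =>
      rw [Function.iterate_succ_apply']
      exact ih.deriv_periodic
  have hchain : ∀ y, deriv F (H y) * deriv^[1] H y = 1 := fun y => by
    have h1 : HasDerivAt (fun y => F (H y)) (deriv F (H y) * deriv^[1] H y) y :=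
      (hFd (H y)).hasDerivAt.comp y (hder 0 y)
    simp only [hFH] at h1
    exact h1.unique (hasDerivAt_id y)
  have hprod : ∀ y, (s * deriv F (H y)) * (s * deriv^[1] H y) = 1 := fun y => by
    calc _ = (s * s) * (deriv F (H y) * deriv^[1] H y) := by ring
      _ = 1 := by rw [hs2, hchain, one_mul]
  have hH1pos : ∀ y, 0 < s * deriv^[1] H y := fun y =>
    pos_of_mul_pos_right (by rw [hprod y]; exact one_pos) (by linarith [hpos (H y)])
  have hH1lt : ∀ y, s * deriv^[1] H y < 1 := fun y => by
    by_contra hcon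
    have h1 := hpos (H y)
    have := hprod y
    nlinarith [not_lt.1 hcon]
  have hwc : Continuous fun y => s * deriv^[1] H y := continuous_const.mul (hsmooth 1).continuous
  have hwp : Function.Periodic (fun y => s * deriv^[1] H y) D := fun y => by simp only [hper 0 y]
  obtain ⟨x₁, hx₁⟩ := exists_bound_of_periodic hDpos.ne' hwc hwp
  have hb := fun n => exists_abs_le_mul_of_periodic hDpos.ne' (hsmooth (n + 1)).continuous
    hwc hH1pos (hper n) hwp
  choose b hb using hb
  have hbm : ∀ n B, b n ≤ B → ∀ y, |deriv^[n+1] H y| ≤ B * (s * deriv^[1] H y) :=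
    fun n B hB y => (hb n y).trans (mul_le_mul_of_nonneg_right hB (hH1pos y).le)
  refine ⟨⟨D, s, hs, H, deriv^[1] H, deriv^[2] H, deriv^[3] H,
    deriv^[4] H, hder 0, hder 1, hder 2, hder 3, fun y => by rw [hlift, hFH], hHD, hper 0, hH1pos,
    s * deriv^[1] H x₁, hH1lt x₁, hx₁, max (b 1) (max (b 2) (b 3)), hbm 1 _ (le_max_left _ _),
    hbm 2 _ (le_max_of_le_right (le_max_left _ _)),
    hbm 3 _ (le_max_of_le_right (le_max_right _ _)), ?_⟩⟩
  rw [(QuotientAddGroup.isQuotientMap_mk (N := AddSubgroup.zmultiples (1:ℝ))).continuous_iff]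
  have : (f ∘ (QuotientAddGroup.mk : ℝ → UnitAddCircle)) = fun x => (F x : UnitAddCircle) :=
    funext hlift
  exact this ▸ (AddCircle.continuous_mk' 1).comp hF.continuous

theorem UnitAddCircle.integral_eq_intervalIntegral (u : UnitAddCircle → ℝ) (t : ℝ) :
    ∫ x, u x = ∫ x in t..t + 1, u (x : UnitAddCircle) :=
  (UnitAddCircle.intervalIntegral_preimage t u).symm

theorem UnitAddCircle.continuous_coe : Continuous ((↑) : ℝ → UnitAddCircle) :=
  AddCircle.continuous_mk' 1

/-- Nonnegative functions on the circle whose logarithm is `a`-Lipschitz. -/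
def LogLipschitz (a : ℝ) (v : C(UnitAddCircle, ℝ)) : Prop :=
  (∀ x, 0 ≤ v x) ∧ ∀ x y : ℝ, v x ≤ Real.exp (a * |x - y|) * v y

/-- Functions whose first three derivatives are bounded by multiples of the function. -/
def DerivBounded (a₁ a₂ a₃ : ℝ) (v : C(UnitAddCircle, ℝ)) : Prop :=
  (∀ x, 0 ≤ v x) ∧ ∃ v₁ v₂ v₃ : ℝ → ℝ,
    (∀ x : ℝ, HasDerivAt (fun x : ℝ => v x) (v₁ x) x ∧ HasDerivAt v₁ (v₂ x) x ∧
      HasDerivAt v₂ (v₃ x) x) ∧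
    ∀ x : ℝ, |v₁ x| ≤ a₁ * v x ∧ |v₂ x| ≤ a₂ * v x ∧ |v₃ x| ≤ a₃ * v x

namespace InverseLift

variable {f : UnitAddCircle → UnitAddCircle} (Φ : InverseLift f)

theorem continuous_H : Continuous Φ.H :=
  continuous_iff_continuousAt.2 fun y => (Φ.hasDerivAt_H y).continuousAt

theorem continuous_H₁ : Continuous Φ.H₁ :=
  continuous_iff_continuousAt.2 fun y => (Φ.hasDerivAt_H₁ y).continuousAt

theorem rate_pos : 0 < Φ.rate := (Φ.H₁_pos 0).trans_le (Φ.H₁_le 0)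

theorem bound_nonneg : 0 ≤ Φ.bound :=
  nonneg_of_mul_nonneg_left ((abs_nonneg _).trans (Φ.H₂_le 0)) (Φ.H₁_pos 0)

theorem abs_sgn : |Φ.sgn| = 1 := by
  rcases Φ.sgn_cases with h | h <;> rw [h] <;> norm_num

theorem coe_H_add (y : ℝ) : (Φ.H (y + Φ.D) : UnitAddCircle) = Φ.H y := by
  rw [Φ.H_add, AddCircle.coe_add]
  rcases Φ.sgn_cases with h | h <;> rw [h] <;> simp

/-- The weight `|H'|` of the transfer operator. -/
def weight (y : ℝ) : ℝ := Φ.sgn * Φ.H₁ y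

theorem weight_pos (y : ℝ) : 0 < Φ.weight y := Φ.H₁_pos y

theorem abs_H₁ (y : ℝ) : |Φ.H₁ y| = Φ.weight y := by
  rw [← abs_of_pos (Φ.weight_pos y), weight, abs_mul, abs_sgn, one_mul]

theorem continuous_weight : Continuous Φ.weight := continuous_const.mul Φ.continuous_H₁

theorem weight_add (y : ℝ) : Φ.weight (y + Φ.D) = Φ.weight y := by
  rw [weight, Φ.H₁_add, weight]

theorem weight_le (x y : ℝ) :
    Φ.weight x ≤ Real.exp (Φ.bound * |x - y|) * Φ.weight y := by
  have hd : ∀ z, HasDerivAt (fun z => Real.log (Φ.weight z)) (Φ.sgn * Φ.H₂ z / Φ.weight z) z :=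
    fun z => ((Φ.hasDerivAt_H₁ z).const_mul Φ.sgn).log (Φ.weight_pos z).ne'
  have h := convex_univ.norm_image_sub_le_of_norm_hasDerivWithin_le (C := Φ.bound)
    (fun z _ => (hd z).hasDerivWithinAt) (fun z _ => by
      rw [Real.norm_eq_abs, abs_div, abs_mul, Φ.abs_sgn, one_mul, abs_of_pos (Φ.weight_pos z),
        div_le_iff₀ (Φ.weight_pos z)]
      exact Φ.H₂_le z) (Set.mem_univ y) (Set.mem_univ x)
  simp only [Real.norm_eq_abs] at h
  have h2 := (le_abs_self _).trans h
  rw [← Real.exp_log (Φ.weight_pos x), ← Real.exp_log (Φ.weight_pos y), ← Real.exp_add]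
  exact Real.exp_le_exp.2 (by linarith)

theorem abs_H_sub_le (x y : ℝ) : |Φ.H x - Φ.H y| ≤ Φ.rate * |x - y| := by
  have h := convex_univ.norm_image_sub_le_of_norm_hasDerivWithin_le (C := Φ.rate)
    (fun z _ => (Φ.hasDerivAt_H z).hasDerivWithinAt) (fun z _ => by
      rw [Real.norm_eq_abs, abs_H₁]; exact Φ.H₁_le z) (Set.mem_univ y) (Set.mem_univ x)
  simpa only [Real.norm_eq_abs] using h

theorem transfer_periodic (v : C(UnitAddCircle, ℝ)) : Function.Periodic
    (fun x : ℝ => ∑ j ∈ Finset.range Φ.D, v (Φ.H (x + j)) * Φ.weight (x + j)) 1 := by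
  intro x
  have h1 := Finset.sum_range_succ (fun j : ℕ => v (Φ.H (x + j)) * Φ.weight (x + j)) Φ.D
  have h2 := Finset.sum_range_succ' (fun j : ℕ => v (Φ.H (x + j)) * Φ.weight (x + j)) Φ.D
  rw [h1] at h2
  rw [Φ.weight_add, Φ.coe_H_add] at h2
  simp only [Nat.cast_zero, add_zero, add_left_inj, Nat.cast_add, Nat.cast_one] at h2
  refine Eq.trans ?_ h2.symm
  exact Finset.sum_congr rfl fun j _ => by
    rw [show x + 1 + (j : ℝ) = x + (j + 1) by ring]

/-- The transfer operator of `f`. -/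
def transferFun (v : C(UnitAddCircle, ℝ)) : C(UnitAddCircle, ℝ) where
  toFun := (Φ.transfer_periodic v).lift
  continuous_toFun := by
    rw [(QuotientAddGroup.isQuotientMap_mk (N := AddSubgroup.zmultiples (1:ℝ))).continuous_iff]
    change Continuous fun x : ℝ => ∑ j ∈ Finset.range Φ.D, v (Φ.H (x + j)) * Φ.weight (x + j)
    have h1 := Φ.continuous_H
    have h2 := Φ.continuous_weight
    have h3 := UnitAddCircle.continuous_coe
    have h4 := v.continuous
    refine continuous_finsetSum _ fun j _ => ?_
    exact (h4.comp (h3.comp (h1.comp (by fun_prop)))).mul (h2.comp (by fun_prop))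

theorem transferFun_coe (v : C(UnitAddCircle, ℝ)) (x : ℝ) : Φ.transferFun v x =
    ∑ j ∈ Finset.range Φ.D, v (Φ.H (x + j)) * Φ.weight (x + j) := rfl

theorem abs_transferFun_le {v w : C(UnitAddCircle, ℝ)} (h : ∀ x, |v x| ≤ w x) (x : UnitAddCircle) :
    |Φ.transferFun v x| ≤ Φ.transferFun w x := by
  induction x using QuotientAddGroup.induction_on with
  | H x =>
    rw [transferFun_coe, transferFun_coe]
    refine (Finset.abs_sum_le_sum_abs _ _).trans (Finset.sum_le_sum fun j _ => ?_)
    rw [abs_mul, abs_of_pos (Φ.weight_pos _)]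
    exact mul_le_mul_of_nonneg_right (h _) (Φ.weight_pos _).le

theorem transferFun_smul (c : ℝ) (v : C(UnitAddCircle, ℝ)) :
    Φ.transferFun (c • v) = c • Φ.transferFun v := by
  ext x
  induction x using QuotientAddGroup.induction_on with
  | H x =>
    rw [ContinuousMap.smul_apply, transferFun_coe, transferFun_coe, smul_eq_mul, Finset.mul_sum]
    exact Finset.sum_congr rfl fun j _ => mul_assoc _ _ _

/-- The transfer operator of `f` as a continuous linear map. -/
def transfer : C(UnitAddCircle, ℝ) →L[ℝ] C(UnitAddCircle, ℝ) :=
  LinearMap.mkContinuous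
    { toFun := Φ.transferFun
      map_add' := fun v w => by
        ext x
        induction x using QuotientAddGroup.induction_on with
        | H x =>
          rw [ContinuousMap.add_apply, transferFun_coe, transferFun_coe, transferFun_coe,
            ← Finset.sum_add_distrib]
          exact Finset.sum_congr rfl fun j _ => add_mul _ _ _
      map_smul' := Φ.transferFun_smul }
    ‖Φ.transferFun 1‖ (fun v => by
      rw [ContinuousMap.norm_le _ (by positivity)]
      intro x
      refine (Φ.abs_transferFun_le (w := ‖v‖ • 1) (fun y => ?_) x).trans ?_
      · simpa using v.norm_coe_le_norm y
      · rw [transferFun_smul, ContinuousMap.smul_apply, smul_eq_mul, mul_comm]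
        exact mul_le_mul_of_nonneg_right
          ((le_abs_self _).trans ((Φ.transferFun 1).norm_coe_le_norm x)) (norm_nonneg _))

theorem transfer_coe (v : C(UnitAddCircle, ℝ)) (x : ℝ) : Φ.transfer v x =
    ∑ j ∈ Finset.range Φ.D, v (Φ.H (x + j)) * Φ.weight (x + j) := rfl

theorem abs_transfer_le {v w : C(UnitAddCircle, ℝ)} (h : ∀ x, |v x| ≤ w x) (x : UnitAddCircle) :
    |Φ.transfer v x| ≤ Φ.transfer w x := Φ.abs_transferFun_le h x

theorem transfer_nonneg {v : C(UnitAddCircle, ℝ)} (h : ∀ x, 0 ≤ v x) (x : UnitAddCircle) :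
    0 ≤ Φ.transfer v x :=
  (abs_nonneg _).trans (Φ.abs_transfer_le (v := v) (w := v) (fun y => (abs_of_nonneg (h y)).le) x)

theorem integral_mul_transfer (ψ v : C(UnitAddCircle, ℝ)) :
    ∫ x, ψ x * Φ.transfer v x = ∫ x, ψ (f x) * v x := by
  have hψ := ψ.continuous
  have hv := v.continuous
  have hf := Φ.continuous_map
  have hH := Φ.continuous_H
  have hw := Φ.continuous_weight
  have hc := UnitAddCircle.continuous_coe
  set E : ℝ → ℝ := fun y => ψ y * (v (Φ.H y) * Φ.weight y) with hE
  have hEc : Continuous E :=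
    (hψ.comp hc).mul ((hv.comp (hc.comp hH)).mul hw)
  have h1 : ∫ x, ψ x * Φ.transfer v x = ∫ y in (0:ℝ)..Φ.D, E y := by
    rw [UnitAddCircle.integral_eq_intervalIntegral _ 0]
    have h2 : ∀ x : ℝ, ψ x * Φ.transfer v x = ∑ j ∈ Finset.range Φ.D, E (x + (j : ℕ)) := by
      intro x
      rw [transfer_coe, Finset.mul_sum]
      refine Finset.sum_congr rfl fun j _ => ?_
      have : ((x + (j : ℝ) : ℝ) : UnitAddCircle) = x := by
        rw [AddCircle.coe_add]
        have h3 : ((j : ℝ) : UnitAddCircle) = 0 := by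
          rw [AddCircle.coe_eq_zero_iff]
          exact ⟨j, by simp⟩
        rw [h3, add_zero]
      simp only [hE, this]
    simp only [h2]
    rw [intervalIntegral.integral_finsetSum (f := fun (j : ℕ) (x : ℝ) => E (x + j)) fun j _ =>
      Continuous.intervalIntegrable (hEc.comp (continuous_add_const (j : ℝ))) _ _]
    have h3 := intervalIntegral.sum_integral_adjacent_intervals (f := E) (μ := volume)
      (a := fun n : ℕ => (n : ℝ)) (n := Φ.D) fun k _ => hEc.intervalIntegrable _ _
    simp only [Nat.cast_zero] at h3
    rw [← h3]
    refine Finset.sum_congr rfl fun j _ => ?_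
    rw [intervalIntegral.integral_comp_add_right]
    congr 1 <;> push_cast <;> ring
  rw [h1]
  have h4 : ∀ y, E y = Φ.sgn * (((fun x : ℝ => ψ (f x) * v x) ∘ Φ.H) y * Φ.H₁ y) := by
    intro y
    simp only [hE, Function.comp, Φ.map_H, weight]; ring
  simp only [h4]
  have h6 : Continuous fun x : ℝ => ψ (f x) * v x := (hψ.comp (hf.comp hc)).mul (hv.comp hc)
  rw [intervalIntegral.integral_const_mul,
    intervalIntegral.integral_comp_mul_deriv (fun y _ => Φ.hasDerivAt_H y)
      Φ.continuous_H₁.continuousOn h6]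
  have h5 := Φ.H_add 0
  rw [zero_add] at h5
  rw [h5]
  rcases Φ.sgn_cases with h | h
  · rw [h, one_mul, ← UnitAddCircle.integral_eq_intervalIntegral (fun x => ψ (f x) * v x)]
  · rw [h, intervalIntegral.integral_symm,
      UnitAddCircle.integral_eq_intervalIntegral _ (Φ.H 0 + -1)]
    simp

theorem integral_transfer (v : C(UnitAddCircle, ℝ)) : ∫ x, Φ.transfer v x = ∫ x, v x := by
  simpa using Φ.integral_mul_transfer 1 v

theorem logLipschitz_transfer {a : ℝ} (ha : 0 ≤ a) {v : C(UnitAddCircle, ℝ)}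
    (hv : LogLipschitz a v) : LogLipschitz (Φ.rate * a + Φ.bound) (Φ.transfer v) := by
  refine ⟨Φ.transfer_nonneg hv.1, fun x y => ?_⟩
  rw [transfer_coe, transfer_coe, Finset.mul_sum]
  refine Finset.sum_le_sum fun j _ => ?_
  have h1 : v (Φ.H (x + j)) ≤ Real.exp (a * (Φ.rate * |x - y|)) * v (Φ.H (y + j)) := by
    refine (hv.2 _ _).trans (mul_le_mul_of_nonneg_right (Real.exp_le_exp.2 ?_) (hv.1 _))
    have := Φ.abs_H_sub_le (x + j) (y + j)
    rw [add_sub_add_right_eq_sub] at this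
    exact mul_le_mul_of_nonneg_left this ha
  have h2 := Φ.weight_le (x + j) (y + j)
  rw [add_sub_add_right_eq_sub] at h2
  calc v (Φ.H (x + j)) * Φ.weight (x + j)
      ≤ (Real.exp (a * (Φ.rate * |x - y|)) * v (Φ.H (y + j))) *
        (Real.exp (Φ.bound * |x - y|) * Φ.weight (y + j)) :=
        mul_le_mul h1 h2 (Φ.weight_pos _).le (mul_nonneg (Real.exp_pos _).le (hv.1 _))
    _ = _ := by
      rw [show (Φ.rate * a + Φ.bound) * |x - y| =
        a * (Φ.rate * |x - y|) + Φ.bound * |x - y| by ring, Real.exp_add]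
      ring

theorem derivBounded_transfer : ∃ a₁ a₂ a₃, 0 ≤ a₁ ∧ 0 ≤ a₂ ∧ 0 ≤ a₃ ∧
    ∀ v : C(UnitAddCircle, ℝ), DerivBounded a₁ a₂ a₃ v →
      DerivBounded a₁ a₂ a₃ (Φ.transfer v) := by
  set l := Φ.rate
  set b := Φ.bound
  have hl : 0 < 1 - l := sub_pos.2 Φ.rate_lt_one
  have hl0 : 0 < l := Φ.rate_pos
  have hb : 0 ≤ b := Φ.bound_nonneg
  obtain ⟨a₁, h₁⟩ : ∃ a, a = b / (1 - l) := ⟨_, rfl⟩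
  have h₁0 : 0 ≤ a₁ := by rw [h₁]; positivity
  obtain ⟨a₂, h₂⟩ : ∃ a, a = (3 * b * a₁ + b) / (1 - l) := ⟨_, rfl⟩
  have h₂0 : 0 ≤ a₂ := by rw [h₂]; positivity
  obtain ⟨a₃, h₃⟩ : ∃ a, a = (6 * b * a₂ + (3 * b * b + 4 * b) * a₁ + b) / (1 - l) := ⟨_, rfl⟩
  have h₃0 : 0 ≤ a₃ := by rw [h₃]; positivity
  rw [eq_div_iff hl.ne'] at h₁ h₂ h₃
  refine ⟨a₁, a₂, a₃, h₁0, h₂0, h₃0, fun v ⟨hv0, v₁, v₂, v₃, hd, hbd⟩ => ?_⟩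
  let E₁ : ℝ → ℝ := fun y => Φ.sgn * (v₁ (Φ.H y) * Φ.H₁ y ^ 2 + v (Φ.H y) * Φ.H₂ y)
  let E₂ : ℝ → ℝ := fun y => Φ.sgn * (v₂ (Φ.H y) * Φ.H₁ y ^ 3 +
    3 * (v₁ (Φ.H y) * (Φ.H₁ y * Φ.H₂ y)) + v (Φ.H y) * Φ.H₃ y)
  let E₃ : ℝ → ℝ := fun y => Φ.sgn * (v₃ (Φ.H y) * Φ.H₁ y ^ 4 +
    6 * (v₂ (Φ.H y) * (Φ.H₁ y ^ 2 * Φ.H₂ y)) +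
    v₁ (Φ.H y) * (3 * Φ.H₂ y ^ 2 + 4 * (Φ.H₁ y * Φ.H₃ y)) + v (Φ.H y) * Φ.H₄ y)
  have hE : ∀ y, HasDerivAt (fun y => v (Φ.H y) * Φ.weight y) (E₁ y) y ∧
      HasDerivAt E₁ (E₂ y) y ∧ HasDerivAt E₂ (E₃ y) y := by
    intro y
    have d0 := (hd (Φ.H y)).1.comp y (Φ.hasDerivAt_H y)
    have d1 := (hd (Φ.H y)).2.1.comp y (Φ.hasDerivAt_H y)
    have d2 := (hd (Φ.H y)).2.2.comp y (Φ.hasDerivAt_H y)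
    have e1 := Φ.hasDerivAt_H₁ y
    have e2 := Φ.hasDerivAt_H₂ y
    have e3 := Φ.hasDerivAt_H₃ y
    refine ⟨?_, ?_, ?_⟩
    · refine (d0.mul (e1.const_mul Φ.sgn)).congr_deriv ?_
      simp only [E₁, Function.comp]; ring
    · refine (((d1.mul (e1.pow 2)).add (d0.mul e2)).const_mul Φ.sgn).congr_deriv ?_
      simp only [E₂, Function.comp, Nat.cast_ofNat, Nat.add_one_sub_one, pow_one, Pi.pow_apply]
      ring
    · refine ((((d2.mul (e1.pow 3)).add ((d1.mul (e1.mul e2)).const_mul 3)).add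
        (d0.mul e3)).const_mul Φ.sgn).congr_deriv ?_
      simp only [E₃, Function.comp, Nat.cast_ofNat, Nat.add_one_sub_one, Pi.pow_apply, Pi.mul_apply]
      ring
  have hEb : ∀ y, |E₁ y| ≤ a₁ * (v (Φ.H y) * Φ.weight y) ∧
      |E₂ y| ≤ a₂ * (v (Φ.H y) * Φ.weight y) ∧ |E₃ y| ≤ a₃ * (v (Φ.H y) * Φ.weight y) := by
    intro y
    obtain ⟨b1, b2, b3⟩ := hbd (Φ.H y)
    have c1 := Φ.abs_H₁ y
    have c2 : |Φ.H₂ y| ≤ b * Φ.weight y := Φ.H₂_le y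
    have c3 : |Φ.H₃ y| ≤ b * Φ.weight y := Φ.H₃_le y
    have c4 : |Φ.H₄ y| ≤ b * Φ.weight y := Φ.H₄_le y
    have hw := Φ.weight_pos y
    have hwl : Φ.weight y ≤ l := Φ.H₁_le y
    have hv := hv0 (Φ.H y)
    generalize Φ.weight y = w at *
    generalize hu : v (Φ.H y) = u at *
    have hw1 : w ≤ 1 := hwl.trans (by linarith)
    have hww : w ^ 2 ≤ l * w := by nlinarith
    have hww3 : w ^ 3 ≤ l * w := by nlinarith
    have hww4 : w ^ 4 ≤ l * w := by nlinarith [mul_pos hw hw]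
    have hww2' : w ^ 2 ≤ w := by nlinarith
    have hww3' : w ^ 3 ≤ w := by nlinarith
    have habs : ∀ t, |Φ.sgn * t| = |t| := fun t => by rw [abs_mul, Φ.abs_sgn, one_mul]
    refine ⟨?_, ?_, ?_⟩
    · calc |E₁ y| ≤ |v₁ (Φ.H y)| * |Φ.H₁ y| ^ 2 + |u * Φ.H₂ y| := by
            simp only [E₁, habs, hu]
            refine (abs_add_le _ _).trans_eq ?_
            rw [abs_mul, abs_pow]
        _ ≤ (a₁ * u) * w ^ 2 + u * (b * w) := by
            rw [c1, abs_mul, abs_of_nonneg hv]; gcongr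
        _ ≤ (a₁ * u) * (l * w) + u * (b * w) := by gcongr
        _ = (a₁ * l + b) * (u * w) := by ring
        _ = a₁ * (u * w) := by rw [← h₁]; ring
    · calc |E₂ y| ≤ |v₂ (Φ.H y)| * |Φ.H₁ y| ^ 3 + 3 * (|v₁ (Φ.H y)| * (|Φ.H₁ y| * |Φ.H₂ y|)) +
            |u * Φ.H₃ y| := by
            simp only [E₂, habs, hu]
            refine (abs_add_three _ _ _).trans_eq ?_
            simp only [abs_mul, abs_pow, abs_of_pos (zero_lt_three (α := ℝ))]
        _ ≤ (a₂ * u) * w ^ 3 + 3 * ((a₁ * u) * (w * (b * w))) + u * (b * w) := by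
            rw [c1, abs_mul, abs_of_nonneg hv]; gcongr
        _ = (a₂ * u) * w ^ 3 + 3 * ((a₁ * u) * (b * w ^ 2)) + u * (b * w) := by ring
        _ ≤ (a₂ * u) * (l * w) + 3 * ((a₁ * u) * (b * w)) + u * (b * w) := by gcongr
        _ = (a₂ * l + (3 * b * a₁ + b)) * (u * w) := by ring
        _ = a₂ * (u * w) := by rw [← h₂]; ring
    · calc |E₃ y| ≤ |v₃ (Φ.H y)| * |Φ.H₁ y| ^ 4 + 6 * (|v₂ (Φ.H y)| * (|Φ.H₁ y| ^ 2 * |Φ.H₂ y|)) +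
            |v₁ (Φ.H y)| * (3 * |Φ.H₂ y| ^ 2 + 4 * (|Φ.H₁ y| * |Φ.H₃ y|)) + |u * Φ.H₄ y| := by
            simp only [E₃, habs, hu]
            refine (abs_add_le _ _).trans (add_le_add_left ((abs_add_three _ _ _).trans ?_) _)
            have h6 : |(6 : ℝ)| = 6 := abs_of_pos (by norm_num)
            have h7 : |3 * Φ.H₂ y ^ 2 + 4 * (Φ.H₁ y * Φ.H₃ y)| ≤
                3 * |Φ.H₂ y| ^ 2 + 4 * (|Φ.H₁ y| * |Φ.H₃ y|) := by
              refine (abs_add_le _ _).trans_eq ?_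
              simp only [abs_mul, abs_pow, abs_of_pos (zero_lt_three (α := ℝ)),
                abs_of_pos (zero_lt_four (α := ℝ))]
            rw [abs_mul (v₁ _), abs_mul (v₃ _), abs_pow, abs_mul 6, abs_mul (v₂ _), abs_mul (_ ^ 2),
              abs_pow, h6]
            gcongr
        _ ≤ (a₃ * u) * w ^ 4 + 6 * ((a₂ * u) * (w ^ 2 * (b * w))) +
            (a₁ * u) * (3 * (b * w) ^ 2 + 4 * (w * (b * w))) + u * (b * w) := by
            rw [c1, abs_mul, abs_of_nonneg hv]; gcongr
        _ = (a₃ * u) * w ^ 4 + 6 * ((a₂ * u) * (b * w ^ 3)) +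
            (a₁ * u) * (3 * (b * b * w ^ 2) + 4 * (b * w ^ 2)) + u * (b * w) := by ring
        _ ≤ (a₃ * u) * (l * w) + 6 * ((a₂ * u) * (b * w)) +
            (a₁ * u) * (3 * (b * b * w) + 4 * (b * w)) + u * (b * w) := by gcongr
        _ = (a₃ * l + (6 * b * a₂ + (3 * b * b + 4 * b) * a₁ + b)) * (u * w) := by ring
        _ = a₃ * (u * w) := by rw [← h₃]; ring
  refine ⟨Φ.transfer_nonneg hv0, fun x => ∑ j ∈ Finset.range Φ.D, E₁ (x + (j : ℕ)),
    fun x => ∑ j ∈ Finset.range Φ.D, E₂ (x + (j : ℕ)),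
    fun x => ∑ j ∈ Finset.range Φ.D, E₃ (x + (j : ℕ)), fun x => ⟨?_, ?_, ?_⟩, fun x => ?_⟩
  · simp only [transfer_coe]
    exact HasDerivAt.fun_sum fun j _ => HasDerivAt.comp_add_const x (j : ℝ) (hE _).1
  · exact HasDerivAt.fun_sum fun j _ => HasDerivAt.comp_add_const x (j : ℝ) (hE _).2.1
  · exact HasDerivAt.fun_sum fun j _ => HasDerivAt.comp_add_const x (j : ℝ) (hE _).2.2
  · rw [transfer_coe, Finset.mul_sum, Finset.mul_sum, Finset.mul_sum]
    exact ⟨(Finset.abs_sum_le_sum_abs _ _).trans (Finset.sum_le_sum fun j _ => (hEb _).1),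
      (Finset.abs_sum_le_sum_abs _ _).trans (Finset.sum_le_sum fun j _ => (hEb _).2.1),
      (Finset.abs_sum_le_sum_abs _ _).trans (Finset.sum_le_sum fun j _ => (hEb _).2.2)⟩

end InverseLift

theorem UnitAddCircle.integral_const (c : ℝ) : ∫ _ : UnitAddCircle, c = c := by
  simp [measureReal_def]

theorem UnitAddCircle.exists_coe_abs_sub_le_one (x y : UnitAddCircle) :
    ∃ s t : ℝ, (s : UnitAddCircle) = x ∧ (t : UnitAddCircle) = y ∧ |s - t| ≤ 1 := by
  have h : ∀ z : UnitAddCircle, ∃ s ∈ Set.Ico (0:ℝ) (0 + 1), (s : UnitAddCircle) = z := fun z => by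
    have : z ∈ ((↑) '' Set.Ico (0:ℝ) (0 + 1) : Set UnitAddCircle) := by
      rw [AddCircle.coe_image_Ico_eq]; trivial
    simpa using this
  obtain ⟨s, hs, rfl⟩ := h x
  obtain ⟨t, ht, rfl⟩ := h y
  refine ⟨s, t, rfl, rfl, abs_le.2 ⟨?_, ?_⟩⟩ <;> linarith [hs.1, hs.2, ht.1, ht.2]

theorem ContinuousMap.integrable_circle (u : C(UnitAddCircle, ℝ)) : Integrable u :=
  u.continuous.integrable_of_hasCompactSupport (HasCompactSupport.of_compactSpace _)

theorem ContinuousMap.integrable_translate (u : C(UnitAddCircle, ℝ)) (ν : Measure ℝ)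
    [IsProbabilityMeasure ν] (x : UnitAddCircle) :
    Integrable (fun s : ℝ => u (x - (s : UnitAddCircle))) ν :=
  Integrable.of_bound
    (u.continuous.comp (continuous_const.sub UnitAddCircle.continuous_coe)).aestronglyMeasurable
    ‖u‖ (Filter.Eventually.of_forall fun _ => u.norm_coe_le_norm _)

/-- The averaging operator `u ↦ ∫ u(x - s) dν(s)`. -/
def noiseAverage (ν : Measure ℝ) [IsProbabilityMeasure ν] :
    C(UnitAddCircle, ℝ) →L[ℝ] C(UnitAddCircle, ℝ) :=
  LinearMap.mkContinuous
    { toFun := fun u =>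
        { toFun := fun x => ∫ s : ℝ, u (x - (s : UnitAddCircle)) ∂ν
          continuous_toFun := by
            have hc := UnitAddCircle.continuous_coe
            have hu := u.continuous
            refine continuous_of_dominated (bound := fun _ => ‖u‖)
              (fun x => (u.integrable_translate ν x).aestronglyMeasurable)
              (fun x => Filter.Eventually.of_forall fun s => u.norm_coe_le_norm _)
              (integrable_const _) (Filter.Eventually.of_forall fun s => ?_)
            fun_prop }
      map_add' := fun u v => by
        ext x
        exact integral_add (u.integrable_translate ν x) (v.integrable_translate ν x)
      map_smul' := fun c u => by
        ext x
        exact integral_const_mul c _ }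
    1 (fun u => by
      rw [ContinuousMap.norm_le _ (by positivity)]
      intro x
      refine (norm_integral_le_integral_norm _).trans ?_
      refine (integral_mono (u.integrable_translate ν x).norm (integrable_const ‖u‖)
        fun s => u.norm_coe_le_norm _).trans ?_
      simp)

section noiseAverage

variable (ν : Measure ℝ) [IsProbabilityMeasure ν]

theorem noiseAverage_apply (u : C(UnitAddCircle, ℝ)) (x : UnitAddCircle) :
    noiseAverage ν u x = ∫ s : ℝ, u (x - (s : UnitAddCircle)) ∂ν := rfl

theorem noiseAverage_nonneg {u : C(UnitAddCircle, ℝ)} (h : ∀ x, 0 ≤ u x) (x : UnitAddCircle) :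
    0 ≤ noiseAverage ν u x := integral_nonneg fun _ => h _

theorem abs_noiseAverage_le {u v : C(UnitAddCircle, ℝ)} (h : ∀ x, |u x| ≤ v x) (x : UnitAddCircle) :
    |noiseAverage ν u x| ≤ noiseAverage ν v x :=
  (norm_integral_le_integral_norm _).trans
    (integral_mono (u.integrable_translate ν x).norm (v.integrable_translate ν x) fun _ => h _)

theorem noiseAverage_dirac_zero (u : C(UnitAddCircle, ℝ)) :
    noiseAverage (Measure.dirac 0) u = u := by
  ext x
  rw [noiseAverage_apply, integral_dirac]
  simp

theorem norm_noiseAverage_le (u : C(UnitAddCircle, ℝ)) : ‖noiseAverage ν u‖ ≤ ‖u‖ := by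
  have := (noiseAverage ν).le_of_opNorm_le (LinearMap.mkContinuous_norm_le _ zero_le_one _) u
  rwa [one_mul] at this

instance isProbabilityMeasure_map_neg : IsProbabilityMeasure (ν.map Neg.neg) :=
  Measure.isProbabilityMeasure_map measurable_neg.aemeasurable

theorem noiseAverage_map_neg_apply (u : C(UnitAddCircle, ℝ)) (x : UnitAddCircle) :
    noiseAverage (ν.map Neg.neg) u x = ∫ s : ℝ, u (x + (s : UnitAddCircle)) ∂ν := by
  have hc := UnitAddCircle.continuous_coe
  have hu := u.continuous
  rw [noiseAverage_apply, integral_map measurable_neg.aemeasurable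
    (u.integrable_translate _ x).aestronglyMeasurable]
  simp

theorem integral_mul_noiseAverage (ψ u : C(UnitAddCircle, ℝ)) :
    ∫ x, ψ x * noiseAverage ν u x = ∫ x, noiseAverage (ν.map Neg.neg) ψ x * u x := by
  have hc := UnitAddCircle.continuous_coe
  have hu := u.continuous
  have hψ := ψ.continuous
  have hb : ∀ x y, ‖ψ x * u y‖ ≤ ‖ψ‖ * ‖u‖ := fun x y => by
    rw [norm_mul]
    exact mul_le_mul (ψ.norm_coe_le_norm _) (u.norm_coe_le_norm _) (norm_nonneg _) (norm_nonneg _)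
  have i1 : Integrable (Function.uncurry fun (x : UnitAddCircle) (s : ℝ) =>
      ψ x * u (x - (s : UnitAddCircle))) (volume.prod ν) :=
    Integrable.of_bound (Continuous.aestronglyMeasurable (by unfold Function.uncurry; fun_prop))
      (‖ψ‖ * ‖u‖) (Filter.Eventually.of_forall fun _ => hb _ _)
  have i2 : Integrable (Function.uncurry fun (s : ℝ) (x : UnitAddCircle) =>
      ψ (x + (s : UnitAddCircle)) * u x) (ν.prod volume) :=
    Integrable.of_bound (Continuous.aestronglyMeasurable (by unfold Function.uncurry; fun_prop))
      (‖ψ‖ * ‖u‖) (Filter.Eventually.of_forall fun _ => hb _ _)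
  simp only [noiseAverage_map_neg_apply]
  simp only [noiseAverage_apply, ← integral_const_mul, ← integral_mul_const]
  rw [integral_integral_swap i1, ← integral_integral_swap i2]
  congr 1
  ext s
  rw [← integral_add_right_eq_self _ (s : UnitAddCircle)]
  simp

theorem noiseAverage_const (c : ℝ) : noiseAverage ν (c • 1) = c • 1 := by
  ext x
  rw [noiseAverage_apply]
  simp

theorem integral_noiseAverage (u : C(UnitAddCircle, ℝ)) : ∫ x, noiseAverage ν u x = ∫ x, u x := by
  have h := integral_mul_noiseAverage ν 1 u
  have h1 : noiseAverage (ν.map Neg.neg) 1 = 1 := by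
    simpa using noiseAverage_const (ν.map Neg.neg) (1 : ℝ)
  rw [h1] at h
  simpa using h

end noiseAverage

namespace LogLipschitz

variable {a : ℝ} {u : C(UnitAddCircle, ℝ)}

theorem mono {b : ℝ} (hab : a ≤ b) (hu : LogLipschitz a u) : LogLipschitz b u :=
  ⟨hu.1, fun x y => (hu.2 x y).trans (mul_le_mul_of_nonneg_right
    (Real.exp_le_exp.2 (mul_le_mul_of_nonneg_right hab (abs_nonneg _))) (hu.1 _))⟩

theorem noiseAverage (ν : Measure ℝ) [IsProbabilityMeasure ν] (hu : LogLipschitz a u) :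
    LogLipschitz a (noiseAverage ν u) := by
  refine ⟨noiseAverage_nonneg ν hu.1, fun x y => ?_⟩
  rw [noiseAverage_apply, noiseAverage_apply, ← integral_const_mul]
  refine integral_mono (u.integrable_translate ν _) ((u.integrable_translate ν _).const_mul _)
    fun s => ?_
  have := hu.2 (x - s) (y - s)
  simpa only [AddCircle.coe_sub, sub_sub_sub_cancel_right] using this

theorem le_exp_mul (ha : 0 ≤ a) (hu : LogLipschitz a u) (x y : UnitAddCircle) :
    u x ≤ Real.exp a * u y := by
  obtain ⟨s, t, rfl, rfl, h⟩ := UnitAddCircle.exists_coe_abs_sub_le_one x y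
  exact (hu.2 s t).trans (mul_le_mul_of_nonneg_right
    (Real.exp_le_exp.2 (mul_le_of_le_one_right ha h)) (hu.1 _))

theorem le_exp_mul_integral (ha : 0 ≤ a) (hu : LogLipschitz a u) (x : UnitAddCircle) :
    u x ≤ Real.exp a * ∫ y, u y := by
  rw [← integral_const_mul, ← UnitAddCircle.integral_const (u x)]
  exact integral_mono (integrable_const _) (u.integrable_circle.const_mul _)
    fun y => hu.le_exp_mul ha x y

theorem integral_le_exp_mul (ha : 0 ≤ a) (hu : LogLipschitz a u) (x : UnitAddCircle) :
    ∫ y, u y ≤ Real.exp a * u x := by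
  rw [← UnitAddCircle.integral_const (Real.exp a * u x)]
  exact integral_mono u.integrable_circle (integrable_const _) fun y => hu.le_exp_mul ha y x

theorem sub_const {t : ℝ} (ha : 0 ≤ a) (ht : 0 ≤ t) (hu : LogLipschitz a u) :
    LogLipschitz ((1 + t) * a)
      (u - (t / (1 + t) * Real.exp (-a) * ∫ y, u y) • (1 : C(UnitAddCircle, ℝ))) := by
  set c := t / (1 + t) * Real.exp (-a) * ∫ y, u y with hc
  have hI : 0 ≤ ∫ y, u y := integral_nonneg hu.1
  have hc0 : 0 ≤ c := by positivity
  have hcu : ∀ x, (1 + t) * c ≤ t * u x := fun x => by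
    have h1 := hu.integral_le_exp_mul ha x
    have h2 : Real.exp (-a) * ∫ y, u y ≤ u x := by
      rw [Real.exp_neg, inv_mul_le_iff₀ (Real.exp_pos _)]; exact h1
    calc (1 + t) * c = t * (Real.exp (-a) * ∫ y, u y) := by rw [hc]; field_simp
      _ ≤ t * u x := mul_le_mul_of_nonneg_left h2 ht
  have hval : ∀ x, (u - c • (1 : C(UnitAddCircle, ℝ))) x = u x - c := fun x => by simp
  refine ⟨fun x => ?_, fun x y => ?_⟩
  · rw [hval]
    have := hcu x
    have := hu.1 x
    by_contra hneg
    nlinarith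
  · rw [hval, hval]
    set z := Real.exp (a * |x - y|)
    have hz : 1 ≤ z := Real.one_le_exp (by positivity)
    have hzt : Real.exp ((1 + t) * a * |x - y|) = z ^ (1 + t) := by
      rw [← Real.exp_mul]; ring_nf
    have hbern : (1 + t) * z - t ≤ z ^ (1 + t) := by
      have := one_add_mul_self_le_rpow_one_add (s := z - 1) (by linarith) (p := 1 + t)
        (by linarith)
      rw [add_sub_cancel] at this
      linarith
    rw [hzt]
    have h1 := hu.2 x y
    have h2 := hcu y
    have h3 : 0 ≤ u y - c := by
      have := hu.1 y
      by_contra hneg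
      nlinarith
    have h4 : c ≤ t * (u y - c) := by linarith
    calc u x - c ≤ z * u y - c := by linarith
      _ = (u y - c) * z + c * (z - 1) := by ring
      _ ≤ (u y - c) * z + t * (u y - c) * (z - 1) :=
        add_le_add_right (mul_le_mul_of_nonneg_right h4 (by linarith)) _
      _ = ((1 + t) * z - t) * (u y - c) := by ring
      _ ≤ z ^ (1 + t) * (u y - c) := mul_le_mul_of_nonneg_right hbern h3

theorem of_one (ha : 0 ≤ a) : LogLipschitz a 1 :=
  ⟨fun _ => zero_le_one, fun x y => by
    simpa using Real.one_le_exp (mul_nonneg ha (abs_nonneg (x - y)))⟩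

end LogLipschitz

namespace InverseLift

variable {f : UnitAddCircle → UnitAddCircle} (Φ : InverseLift f)

/-- The transfer operator of the noisy map. -/
def noisyTransfer (ν : Measure ℝ) [IsProbabilityMeasure ν] :
    C(UnitAddCircle, ℝ) →L[ℝ] C(UnitAddCircle, ℝ) := (noiseAverage ν).comp Φ.transfer

theorem noisyTransfer_apply (ν : Measure ℝ) [IsProbabilityMeasure ν] (u : C(UnitAddCircle, ℝ)) :
    Φ.noisyTransfer ν u = noiseAverage ν (Φ.transfer u) := rfl

theorem integral_noisyTransfer (ν : Measure ℝ) [IsProbabilityMeasure ν]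
    (u : C(UnitAddCircle, ℝ)) : ∫ x, Φ.noisyTransfer ν u x = ∫ x, u x := by
  rw [noisyTransfer_apply, integral_noiseAverage, integral_transfer]

theorem abs_noisyTransfer_le (ν : Measure ℝ) [IsProbabilityMeasure ν] {u v : C(UnitAddCircle, ℝ)}
    (h : ∀ x, |u x| ≤ v x) (x : UnitAddCircle) :
    |Φ.noisyTransfer ν u x| ≤ Φ.noisyTransfer ν v x :=
  abs_noiseAverage_le ν (Φ.abs_transfer_le h) x

theorem exists_contraction : ∃ a r : ℝ, 0 < a ∧ 0 ≤ r ∧ r < 1 ∧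
    ∀ (ν : Measure ℝ) [IsProbabilityMeasure ν],
      (∀ u, LogLipschitz a u → LogLipschitz a (Φ.noisyTransfer ν u)) ∧
      ∀ (k : ℕ) (u v : C(UnitAddCircle, ℝ)), LogLipschitz a u → LogLipschitz a v →
        ∫ x, u x = ∫ x, v x →
        ‖(Φ.noisyTransfer ν ^ k) u - (Φ.noisyTransfer ν ^ k) v‖ ≤
          Real.exp a * (∫ x, u x) * r ^ k := by
  have hl := Φ.rate_lt_one
  have hl0 := Φ.rate_pos
  have hb := Φ.bound_nonneg
  obtain ⟨t, ht⟩ : ∃ t, t = (1 - Φ.rate) / (2 * Φ.rate) := ⟨_, rfl⟩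
  obtain ⟨a, ha⟩ : ∃ a, a = 2 * Φ.bound / (1 - Φ.rate) + 1 := ⟨_, rfl⟩
  have hl1 : 0 < 1 - Φ.rate := sub_pos.2 hl
  have ht0 : 0 < t := by rw [ht]; positivity
  have ha0 : 0 < a := by rw [ha]; positivity
  have hrt : Φ.rate * (1 + t) = (1 + Φ.rate) / 2 := by rw [ht]; field_simp; ring
  have hba : 2 * Φ.bound ≤ a * (1 - Φ.rate) := by
    rw [ha, add_mul, div_mul_cancel₀ _ hl1.ne']; linarith
  have hclose : Φ.rate * ((1 + t) * a) + Φ.bound ≤ a := by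
    rw [← mul_assoc, hrt]; linarith
  obtain ⟨d, hd⟩ : ∃ d, d = t / (1 + t) * Real.exp (-a) := ⟨_, rfl⟩
  have hd0 : 0 < d := by rw [hd]; positivity
  have hd1 : d ≤ 1 := by
    rw [hd]
    exact mul_le_one₀ ((div_le_one (by linarith)).2 (by linarith)) (Real.exp_pos _).le
      (Real.exp_le_one_iff.2 (by linarith))
  have hmap : ∀ (ν : Measure ℝ) [IsProbabilityMeasure ν] (u), LogLipschitz ((1 + t) * a) u →
      LogLipschitz a (Φ.noisyTransfer ν u) := fun ν _ u hu =>
    ((Φ.logLipschitz_transfer (by positivity) hu).mono hclose).noiseAverage ν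
  refine ⟨a, 1 - d, ha0, by linarith, by linarith, fun ν _ => ⟨fun u hu => hmap ν u
    (hu.mono (by nlinarith)), fun k u v hu hv huv => ?_⟩⟩
  have hstep : ∀ u, LogLipschitz a u → ∫ x, Φ.noisyTransfer ν
      (u - (d * ∫ y, u y) • (1 : C(UnitAddCircle, ℝ))) x = (1 - d) * ∫ x, u x := fun u _ => by
    rw [integral_noisyTransfer]
    simp only [ContinuousMap.sub_apply, ContinuousMap.smul_apply, ContinuousMap.one_apply,
      smul_eq_mul, mul_one]
    rw [integral_sub u.integrable_circle (integrable_const _), UnitAddCircle.integral_const]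
    ring
  have key : ∀ k : ℕ, ∀ u v, LogLipschitz a u → LogLipschitz a v → ∫ x, u x = ∫ x, v x →
      ∃ u' v', LogLipschitz a u' ∧ LogLipschitz a v' ∧ ∫ x, u' x = (∫ x, u x) * (1 - d) ^ k ∧
        ∫ x, v' x = (∫ x, u x) * (1 - d) ^ k ∧
        (Φ.noisyTransfer ν ^ k) u - (Φ.noisyTransfer ν ^ k) v = u' - v' := by
    intro k
    induction k with
    | zero => exact fun u v hu hv huv => ⟨u, v, hu, hv, by simp, by simp [huv], by simp⟩
    | succ k ih =>
      intro u v hu hv huv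
      have hu1 := hmap ν _ (hd ▸ hu.sub_const ha0.le ht0.le)
      have hv1 := hmap ν _ (hd ▸ hv.sub_const ha0.le ht0.le)
      obtain ⟨u', v', h1, h2, h3, h4, h5⟩ := ih _ _ hu1 hv1 (by rw [hstep u hu, hstep v hv, huv])
      refine ⟨u', v', h1, h2, ?_, ?_, ?_⟩
      · rw [h3, hstep u hu]; ring
      · rw [h4, hstep u hu]; ring
      · rw [← h5, huv, ← map_sub, ← map_sub, ← map_sub, sub_sub_sub_cancel_right, pow_succ]
        rfl
  obtain ⟨u', v', h1, h2, h3, h4, h5⟩ := key k u v hu hv huv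
  have hI : 0 ≤ ∫ x, u x := integral_nonneg hu.1
  rw [h5, ContinuousMap.norm_le _ (by positivity)]
  intro x
  have e1 := h1.le_exp_mul_integral ha0.le x
  have e2 := h2.le_exp_mul_integral ha0.le x
  rw [h3] at e1
  rw [h4] at e2
  have e3 := h1.1 x
  have e4 := h2.1 x
  rw [ContinuousMap.sub_apply, Real.norm_eq_abs, abs_le]
  constructor <;> linarith

end InverseLift

theorem UnitAddCircle.norm_coe_le_abs (x : ℝ) : ‖(x : UnitAddCircle)‖ ≤ |x| :=
  UnitAddCircle.norm_eq.trans_le (by simpa using round_le x 0)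

/-- The subalgebra of Lipschitz functions on the circle. -/
def lipschitzSubalgebra : Subalgebra ℝ C(UnitAddCircle, ℝ) where
  carrier := {u | ∃ L, 0 ≤ L ∧ ∀ x y : ℝ, |u x - u y| ≤ L * |x - y|}
  mul_mem' := by
    rintro u v ⟨L, hL, hu⟩ ⟨M, hM, hv⟩
    refine ⟨‖u‖ * M + L * ‖v‖, by positivity, fun x y => ?_⟩
    have h1 : |u x| ≤ ‖u‖ := u.norm_coe_le_norm x
    have h2 : |v y| ≤ ‖v‖ := v.norm_coe_le_norm y
    calc |(u * v) x - (u * v) y| = |u x * (v x - v y) + (u x - u y) * v y| := by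
          rw [ContinuousMap.mul_apply, ContinuousMap.mul_apply]; ring_nf
      _ ≤ |u x| * |v x - v y| + |u x - u y| * |v y| := by
          rw [← abs_mul, ← abs_mul]; exact abs_add_le _ _
      _ ≤ ‖u‖ * (M * |x - y|) + (L * |x - y|) * ‖v‖ := by
          gcongr
          · exact hv x y
          · exact hu x y
      _ = _ := by ring
  add_mem' := by
    rintro u v ⟨L, hL, hu⟩ ⟨M, hM, hv⟩
    refine ⟨L + M, by positivity, fun x y => ?_⟩
    rw [ContinuousMap.add_apply, ContinuousMap.add_apply, add_sub_add_comm, add_mul]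
    exact (abs_add_le _ _).trans (add_le_add (hu x y) (hv x y))
  algebraMap_mem' := fun c => ⟨0, le_rfl, fun x y => by simp⟩

theorem lipschitzSubalgebra_topologicalClosure :
    lipschitzSubalgebra.topologicalClosure = ⊤ := by
  refine ContinuousMap.subalgebra_topologicalClosure_eq_top_of_separatesPoints _ ?_
  intro p q hpq
  refine ⟨fun x => ‖x - p‖, ⟨⟨fun x => ‖x - p‖, by fun_prop⟩, ⟨1, zero_le_one, fun x y => ?_⟩, rfl⟩,
    ?_⟩
  · rw [one_mul]
    refine (abs_norm_sub_norm_le ((x : UnitAddCircle) - p) (y - p)).trans ?_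
    rw [sub_sub_sub_cancel_right, ← AddCircle.coe_sub]
    exact UnitAddCircle.norm_coe_le_abs _
  · simp only [sub_self, norm_zero]
    exact (norm_ne_zero_iff.2 (sub_ne_zero.2 hpq.symm)).symm

theorem exists_lipschitz_integral_sub_le {ρ : UnitAddCircle → ℝ} (hρ : Integrable ρ) {η : ℝ}
    (hη : 0 < η) : ∃ w : C(UnitAddCircle, ℝ), (∃ L, 0 ≤ L ∧ ∀ x y : ℝ, |w x - w y| ≤ L * |x - y|) ∧
      ∫ x, |ρ x - w x| ≤ η := by
  obtain ⟨g, hg, hgi⟩ := hρ.exists_boundedContinuous_integral_sub_le (half_pos hη)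
  have hmem : g.toContinuousMap ∈ closure (lipschitzSubalgebra : Set C(UnitAddCircle, ℝ)) := by
    have h := lipschitzSubalgebra_topologicalClosure
    have h2 : g.toContinuousMap ∈ lipschitzSubalgebra.topologicalClosure := h ▸ trivial
    exact h2
  obtain ⟨w, hw, hdist⟩ := Metric.mem_closure_iff.1 hmem (η / 2) (half_pos hη)
  refine ⟨w, hw, ?_⟩
  have hb : ∀ x, |g x - w x| ≤ η / 2 := fun x => by
    have h1 := (ContinuousMap.dist_apply_le_dist (f := g.toContinuousMap) (g := w) x)
    rw [Real.dist_eq] at h1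
    exact h1.trans hdist.le
  have i1 : Integrable fun x => |ρ x - g x| := (hρ.sub hgi).abs
  have hgw : Integrable fun x => |g x - w x| := (hgi.sub w.integrable_circle).abs
  calc ∫ x, |ρ x - w x| ≤ ∫ x, (|ρ x - g x| + |g x - w x|) :=
        integral_mono (hρ.sub w.integrable_circle).abs (i1.add hgw) fun x => abs_sub_le _ _ _
    _ = (∫ x, |ρ x - g x|) + ∫ x, |g x - w x| := integral_add i1 hgw
    _ ≤ η / 2 + ∫ _ : UnitAddCircle, η / 2 :=
        add_le_add hg (integral_mono hgw (integrable_const _) hb)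
    _ = η := by rw [UnitAddCircle.integral_const]; ring

theorem abs_integral_mul_le {g : UnitAddCircle → ℝ} (hg : Integrable g)
    (u : C(UnitAddCircle, ℝ)) : |∫ x, g x * u x| ≤ (∫ x, |g x|) * ‖u‖ := by
  rw [← integral_mul_const]
  refine norm_integral_le_of_norm_le (f := fun x => g x * u x) (hg.abs.mul_const _)
    (Filter.Eventually.of_forall fun x => ?_)
  rw [norm_mul]
  exact mul_le_mul_of_nonneg_left (u.norm_coe_le_norm x) (norm_nonneg _)

theorem MeasureTheory.Integrable.mul_continuousMap {g : UnitAddCircle → ℝ} (hg : Integrable g)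
    (u : C(UnitAddCircle, ℝ)) : Integrable fun x => g x * u x :=
  hg.mul_bdd (c := ‖u‖) u.continuous.aestronglyMeasurable
    (Filter.Eventually.of_forall u.norm_coe_le_norm)

/-- Integration against an integrable function. -/
def integralMul (g : UnitAddCircle → ℝ) (hg : Integrable g) : C(UnitAddCircle, ℝ) →L[ℝ] ℝ :=
  LinearMap.mkContinuous
    { toFun := fun u => ∫ x, g x * u x
      map_add' := fun u v => by
        simp only [ContinuousMap.add_apply, mul_add]
        exact integral_add (hg.mul_continuousMap u) (hg.mul_continuousMap v)
      map_smul' := fun c u => by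
        simp only [ContinuousMap.smul_apply, smul_eq_mul, RingHom.id_apply, mul_left_comm (g _)]
        exact integral_const_mul _ _ }
    (∫ x, |g x|) (abs_integral_mul_le hg)

theorem integralMul_apply {g : UnitAddCircle → ℝ} (hg : Integrable g) (u : C(UnitAddCircle, ℝ)) :
    integralMul g hg u = ∫ x, g x * u x := rfl

/-- `ρ` is a stationary density of `x ↦ f x + s`, `s` distributed according to `ν`, tested against
continuous functions. -/
def IsStationaryDensity (f : UnitAddCircle → UnitAddCircle) (ν : Measure ℝ) [IsProbabilityMeasure ν]
    (ρ : UnitAddCircle → ℝ) : Prop :=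
  IsProbDensity ρ ∧ ∀ ψ : C(UnitAddCircle, ℝ),
    ∫ x, ρ x * noiseAverage (ν.map Neg.neg) ψ (f x) = ∫ x, ρ x * ψ x

namespace InverseLift

variable {f : UnitAddCircle → UnitAddCircle} (Φ : InverseLift f)

theorem exists_decay : ∃ C r : ℝ, 0 < C ∧ 0 ≤ r ∧ r < 1 ∧
    ∀ (ν : Measure ℝ) [IsProbabilityMeasure ν] (k : ℕ) (u : C(UnitAddCircle, ℝ)) (L : ℝ), 0 ≤ L →
      (∀ x y : ℝ, |u x - u y| ≤ L * |x - y|) → ∫ x, u x = 0 →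
        ‖(Φ.noisyTransfer ν ^ k) u‖ ≤ C * L * r ^ k := by
  obtain ⟨a, r, ha, hr0, hr1, h⟩ := Φ.exists_contraction
  refine ⟨Real.exp a * (1 + 1 / a), r, by positivity, hr0, hr1, fun ν _ k u L hL hu h0 => ?_⟩
  obtain ⟨c, hc⟩ : ∃ c, c = L * (1 + 1 / a) := ⟨_, rfl⟩
  have hc0 : 0 ≤ c := by rw [hc]; positivity
  have hca : a * (c - L) = L := by rw [hc]; field_simp; ring
  have hub : ∀ x, -L ≤ u x := fun x => by
    have h1 : ∀ y, u y - u x ≤ L := fun y => by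
      obtain ⟨s, t, rfl, rfl, hst⟩ := UnitAddCircle.exists_coe_abs_sub_le_one y x
      exact (le_abs_self _).trans ((hu s t).trans (mul_le_of_le_one_right hL hst))
    have h2 : ∫ y, (u y - u x) ≤ ∫ _ : UnitAddCircle, L :=
      integral_mono (u.integrable_circle.sub (integrable_const _)) (integrable_const _) h1
    rw [integral_sub u.integrable_circle (integrable_const _), UnitAddCircle.integral_const,
      UnitAddCircle.integral_const, h0] at h2
    linarith
  have hval : ∀ x, (u + c • (1 : C(UnitAddCircle, ℝ))) x = u x + c := fun x => by simp
  have hval' : ∀ x, (c • (1 : C(UnitAddCircle, ℝ))) x = c := fun x => by simp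
  have hcone : LogLipschitz a (u + c • (1 : C(UnitAddCircle, ℝ))) := by
    have hpos : ∀ x, c - L ≤ u x + c := fun x => by linarith [hub x]
    have hcL : 0 ≤ c - L := nonneg_of_mul_nonneg_right (by rw [hca]; exact hL) ha
    refine ⟨fun x => by rw [hval]; linarith [hpos x], fun x y => ?_⟩
    rw [hval, hval]
    have h1 := (le_abs_self _).trans (hu x y)
    have h2 := Real.add_one_le_exp (a * |x - y|)
    have h3 := hpos y
    calc u x + c ≤ L * |x - y| + (u y + c) := by linarith
      _ = (c - L) * (a * |x - y|) + (u y + c) := by rw [← mul_assoc, mul_comm (c - L), hca]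
      _ ≤ (u y + c) * (a * |x - y|) + (u y + c) := by gcongr
      _ = (a * |x - y| + 1) * (u y + c) := by ring
      _ ≤ _ := mul_le_mul_of_nonneg_right h2 (by linarith)
  have hconst : LogLipschitz a (c • (1 : C(UnitAddCircle, ℝ))) :=
    ⟨fun x => by rw [hval']; exact hc0, fun x y => by
      rw [hval', hval']
      exact le_mul_of_one_le_left hc0 (Real.one_le_exp (by positivity))⟩
  have hint : ∫ x, (u + c • (1 : C(UnitAddCircle, ℝ))) x = c := by
    simp only [hval]
    rw [integral_add u.integrable_circle (integrable_const _), h0, zero_add,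
      UnitAddCircle.integral_const]
  have key := (h ν).2 k _ _ hcone hconst (by
    rw [hint]; simp only [hval', UnitAddCircle.integral_const])
  rw [map_add, add_sub_cancel_right, hint] at key
  refine key.trans_eq ?_
  rw [hc]; ring

theorem integral_noisyTransfer_pow (ν : Measure ℝ) [IsProbabilityMeasure ν] (n : ℕ)
    (u : C(UnitAddCircle, ℝ)) : ∫ x, (Φ.noisyTransfer ν ^ n) u x = ∫ x, u x := by
  induction n with
  | zero => simp
  | succ n ih => rw [pow_succ', mul_apply_eq_comp, integral_noisyTransfer, ih]

theorem exists_fixed (ν : Measure ℝ) [IsProbabilityMeasure ν] :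
    ∃ ρ : C(UnitAddCircle, ℝ), (∀ x, 0 ≤ ρ x) ∧ ∫ x, ρ x = 1 ∧ Φ.noisyTransfer ν ρ = ρ ∧
      Filter.Tendsto (fun n => (Φ.noisyTransfer ν ^ n) 1) Filter.atTop (nhds ρ) := by
  obtain ⟨a, r, ha, hr0, hr1, h⟩ := Φ.exists_contraction
  set A := Φ.noisyTransfer ν with hA
  have hcone : ∀ n, LogLipschitz a ((A ^ n) 1) := fun n => by
    induction n with
    | zero => exact LogLipschitz.of_one ha.le
    | succ n ih => rw [pow_succ']; exact (h ν).1 _ ih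
  have hint1 : ∫ x, (1 : C(UnitAddCircle, ℝ)) x = 1 := UnitAddCircle.integral_const 1
  have hcauchy : CauchySeq fun n => (A ^ n) (1 : C(UnitAddCircle, ℝ)) := by
    refine cauchySeq_of_le_geometric r (Real.exp a) hr1 fun n => ?_
    rw [dist_eq_norm, pow_succ, mul_apply_eq_comp]
    have := (h ν).2 n 1 (A 1) (hcone 0) (hcone 1) (by rw [integral_noisyTransfer])
    rwa [hint1, mul_one] at this
  obtain ⟨ρ, hρ⟩ := cauchySeq_tendsto_of_complete hcauchy
  have heval : ∀ x, Filter.Tendsto (fun n => (A ^ n) 1 x) Filter.atTop (nhds (ρ x)) := fun x =>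
    ((continuous_eval_const x).tendsto ρ).comp hρ
  refine ⟨ρ, fun x => ge_of_tendsto (heval x) (Filter.Eventually.of_forall fun n => (hcone n).1 x),
    ?_, ?_, hρ⟩
  · have h1 := ((integralMul _ (integrable_const (1 : ℝ))).continuous.tendsto ρ).comp hρ
    simp only [Function.comp_def, integralMul_apply, one_mul, hA, integral_noisyTransfer_pow] at h1
    exact tendsto_nhds_unique h1 (by rw [hint1]; exact tendsto_const_nhds)
  · have h1 := (A.continuous.tendsto ρ).comp hρ
    have h2 := hρ.comp (Filter.tendsto_add_atTop_nat 1)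
    refine tendsto_nhds_unique h1 (h2.congr fun n => ?_)
    simp only [Function.comp_apply, pow_succ', mul_apply_eq_comp]

theorem isStationaryDensity_of_fixed {ν : Measure ℝ} [IsProbabilityMeasure ν]
    {ρ : C(UnitAddCircle, ℝ)}
    (h0 : ∀ x, 0 ≤ ρ x) (h1 : ∫ x, ρ x = 1) (hfix : Φ.noisyTransfer ν ρ = ρ) :
    IsStationaryDensity f ν ρ := by
  refine ⟨⟨ρ.integrable_circle, Filter.Eventually.of_forall h0, h1⟩, fun ψ => ?_⟩
  have h2 := Φ.integral_mul_transfer (noiseAverage (ν.map Neg.neg) ψ) ρ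
  rw [← integral_mul_noiseAverage, ← noisyTransfer_apply, hfix] at h2
  simp only [mul_comm (ρ _)]
  exact h2.symm

/-- The dual of the noisy transfer operator. -/
def koopman (ν : Measure ℝ) [IsProbabilityMeasure ν] (ψ : C(UnitAddCircle, ℝ)) :
    C(UnitAddCircle, ℝ) := (noiseAverage (ν.map Neg.neg) ψ).comp ⟨f, Φ.continuous_map⟩

theorem integral_mul_koopman (ν : Measure ℝ) [IsProbabilityMeasure ν]
    (w ψ : C(UnitAddCircle, ℝ)) :
    ∫ x, w x * Φ.koopman ν ψ x = ∫ x, Φ.noisyTransfer ν w x * ψ x := by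
  have h := Φ.integral_mul_transfer (noiseAverage (ν.map Neg.neg) ψ) w
  rw [← integral_mul_noiseAverage] at h
  simp only [mul_comm (w _), mul_comm _ (ψ _)]
  exact h.symm

theorem integral_mul_koopman_iterate (ν : Measure ℝ) [IsProbabilityMeasure ν] (n : ℕ)
    (w ψ : C(UnitAddCircle, ℝ)) :
    ∫ x, w x * ((Φ.koopman ν)^[n] ψ) x = ∫ x, (Φ.noisyTransfer ν ^ n) w x * ψ x := by
  induction n generalizing ψ with
  | zero => rfl
  | succ n ih =>
    rw [Function.iterate_succ_apply, ih, integral_mul_koopman, pow_succ']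
    rfl

theorem norm_koopman_iterate_le (ν : Measure ℝ) [IsProbabilityMeasure ν] (n : ℕ)
    (ψ : C(UnitAddCircle, ℝ)) : ‖(Φ.koopman ν)^[n] ψ‖ ≤ ‖ψ‖ := by
  induction n with
  | zero => rfl
  | succ n ih =>
    rw [Function.iterate_succ_apply', ContinuousMap.norm_le _ (norm_nonneg _)]
    intro x
    have h := (noiseAverage (ν.map Neg.neg) ((Φ.koopman ν)^[n] ψ)).norm_coe_le_norm (f x)
    exact h.trans ((norm_noiseAverage_le _ _).trans ih)

theorem tendsto_pow_of_lipschitz {ν : Measure ℝ} [IsProbabilityMeasure ν]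
    {ρ : C(UnitAddCircle, ℝ)}
    (hlim : Filter.Tendsto (fun n => (Φ.noisyTransfer ν ^ n) 1) Filter.atTop (nhds ρ))
    {w : C(UnitAddCircle, ℝ)} {L : ℝ} (hL : 0 ≤ L)
    (hw : ∀ x y : ℝ, |w x - w y| ≤ L * |x - y|) :
    Filter.Tendsto (fun n => (Φ.noisyTransfer ν ^ n) w) Filter.atTop
      (nhds ((∫ x, w x) • ρ)) := by
  obtain ⟨C, r, hC, hr0, hr1, hdecay⟩ := Φ.exists_decay
  set m := ∫ x, w x
  have h1 : Filter.Tendsto (fun n => (Φ.noisyTransfer ν ^ n) (w - m • 1)) Filter.atTop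
      (nhds 0) := by
    refine squeeze_zero_norm (fun n => hdecay ν n _ L hL (fun x y => ?_) ?_) (a := fun n =>
      C * L * r ^ n) ?_
    · simpa using hw x y
    · simp only [ContinuousMap.sub_apply, ContinuousMap.smul_apply, ContinuousMap.one_apply,
        smul_eq_mul, mul_one]
      rw [integral_sub w.integrable_circle (integrable_const _), UnitAddCircle.integral_const]
      exact sub_self _
    · simpa using (tendsto_pow_atTop_nhds_zero_of_lt_one hr0 hr1).const_mul (C * L)
  have h2 := h1.add (hlim.const_smul m)
  rw [zero_add] at h2
  refine h2.congr fun n => ?_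
  rw [map_sub, map_smul, sub_add_cancel]

theorem integral_eq_of_isStationaryDensity {ν : Measure ℝ} [IsProbabilityMeasure ν]
    {ρ : C(UnitAddCircle, ℝ)}
    (hlim : Filter.Tendsto (fun n => (Φ.noisyTransfer ν ^ n) 1) Filter.atTop (nhds ρ))
    {ρ' : UnitAddCircle → ℝ} (hρ' : IsStationaryDensity f ν ρ') (ψ : C(UnitAddCircle, ℝ)) :
    ∫ x, ρ' x * ψ x = ∫ x, ρ x * ψ x := by
  set K := Φ.koopman ν
  have hstat : ∀ n, ∫ x, ρ' x * (K^[n] ψ) x = ∫ x, ρ' x * ψ x := fun n => by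
    induction n with
    | zero => rfl
    | succ n ih => rw [Function.iterate_succ_apply', ← ih]; exact hρ'.2 _
  have hi := hρ'.1.integrable
  set B := ∫ x, ρ x * ψ x
  refine eq_of_forall_dist_le fun η hη => ?_
  obtain ⟨e, he⟩ : ∃ e, e = η / (‖ψ‖ + |B| + 1) := ⟨_, rfl⟩
  have he0 : 0 < e := by rw [he]; positivity
  obtain ⟨w, ⟨L, hL, hw⟩, hdist⟩ := exists_lipschitz_integral_sub_le hi he0
  set m := ∫ x, w x
  have hm : |1 - m| ≤ e := by
    rw [← hρ'.1.integral_eq_one, ← integral_sub hi w.integrable_circle]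
    exact (norm_integral_le_integral_norm fun x => ρ' x - w x).trans hdist
  have hlimw := Φ.tendsto_pow_of_lipschitz hlim hL hw
  have hlim2 : Filter.Tendsto (fun n => ∫ x, w x * (K^[n] ψ) x) Filter.atTop (nhds (m * B)) := by
    have h1 := ((integralMul _ ψ.integrable_circle).continuous.tendsto _).comp hlimw
    rw [map_smul, smul_eq_mul, integralMul_apply] at h1
    simp only [Function.comp_def, integralMul_apply, mul_comm (ψ _)] at h1
    exact h1.congr fun n => (Φ.integral_mul_koopman_iterate ν n w ψ).symm
  have hbound : ∀ n, |(∫ x, ρ' x * ψ x) - ∫ x, w x * (K^[n] ψ) x| ≤ e * ‖ψ‖ := fun n => by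
    rw [← hstat n, ← integral_sub (hi.mul_continuousMap _) (w.integrable_circle.mul_continuousMap _)]
    simp only [← sub_mul]
    exact (abs_integral_mul_le (hi.sub w.integrable_circle) _).trans
      (mul_le_mul hdist (Φ.norm_koopman_iterate_le ν n ψ) (norm_nonneg _) he0.le)
  have h1 : |(∫ x, ρ' x * ψ x) - m * B| ≤ e * ‖ψ‖ :=
    le_of_tendsto (hlim2.const_sub _).abs (Filter.Eventually.of_forall hbound)
  have h2 : |m * B - B| ≤ e * |B| := by
    rw [show m * B - B = -((1 - m) * B) by ring, abs_neg, abs_mul]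
    exact mul_le_mul_of_nonneg_right hm (abs_nonneg _)
  rw [Real.dist_eq]
  calc _ ≤ e * ‖ψ‖ + e * |B| := (abs_sub_le _ _ _).trans (add_le_add h1 h2)
    _ ≤ e * (‖ψ‖ + |B| + 1) := by linarith
    _ = η := by rw [he]; field_simp

end InverseLift

namespace IsProbDensity

variable {X : Type*} [MeasureSpace X] {ρ : X → ℝ}

theorem isProbabilityMeasure (hρ : IsProbDensity ρ) : IsProbabilityMeasure (densityMeasure ρ) := by
  constructor
  rw [densityMeasure, withDensity_apply _ MeasurableSet.univ, Measure.restrict_univ,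
    ← ofReal_integral_eq_lintegral_ofReal hρ.integrable hρ.nonneg, hρ.integral_eq_one,
    ENNReal.ofReal_one]

theorem integral_densityMeasure (hρ : IsProbDensity ρ) (ψ : X → ℝ) :
    ∫ x, ψ x ∂densityMeasure ρ = ∫ x, ρ x * ψ x := by
  rw [densityMeasure, integral_withDensity_eq_integral_toReal_smul₀
    hρ.integrable.aestronglyMeasurable.aemeasurable.ennreal_ofReal
    (Filter.Eventually.of_forall fun _ => ENNReal.ofReal_lt_top)]
  refine integral_congr_ae ?_
  filter_upwards [hρ.nonneg] with x hx
  rw [ENNReal.toReal_ofReal hx, smul_eq_mul]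

theorem ae_eq_of_densityMeasure_eq {ρ' : X → ℝ} (hρ : IsProbDensity ρ) (hρ' : IsProbDensity ρ')
    (h : densityMeasure ρ = densityMeasure ρ') : ρ =ᵐ[volume] ρ' := by
  have h1 := (withDensity_eq_iff hρ.integrable.aestronglyMeasurable.aemeasurable.ennreal_ofReal
    hρ'.integrable.aestronglyMeasurable.aemeasurable.ennreal_ofReal
    (by
      rw [← ofReal_integral_eq_lintegral_ofReal hρ.integrable hρ.nonneg]
      exact ENNReal.ofReal_ne_top)).1 h
  filter_upwards [h1, hρ.nonneg, hρ'.nonneg] with x h1 h2 h3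
  exact (ENNReal.ofReal_eq_ofReal_iff h2 h3).1 h1

end IsProbDensity

theorem measure_circle_eq_iff {μ₁ μ₂ : Measure UnitAddCircle} [IsFiniteMeasure μ₁]
    [IsFiniteMeasure μ₂] :
    μ₁ = μ₂ ↔ ∀ ψ : C(UnitAddCircle, ℝ), ∫ x, ψ x ∂μ₁ = ∫ x, ψ x ∂μ₂ :=
  ⟨fun h _ => by rw [h], fun h => ext_of_forall_integral_eq_of_IsFiniteMeasure fun ψ =>
    h ψ.toContinuousMap⟩

theorem ae_eq_of_integral_mul_eq {ρ ρ' : UnitAddCircle → ℝ} (hρ : IsProbDensity ρ)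
    (hρ' : IsProbDensity ρ')
    (h : ∀ ψ : C(UnitAddCircle, ℝ), ∫ x, ρ x * ψ x = ∫ x, ρ' x * ψ x) : ρ =ᵐ[volume] ρ' := by
  have := hρ.isProbabilityMeasure
  have := hρ'.isProbabilityMeasure
  refine hρ.ae_eq_of_densityMeasure_eq hρ' (measure_circle_eq_iff.2 fun ψ => ?_)
  rw [hρ.integral_densityMeasure, hρ'.integral_densityMeasure, h]

theorem isInvariantDensity_iff {f : UnitAddCircle → UnitAddCircle} (hf : Continuous f)
    (ρ : UnitAddCircle → ℝ) :
    IsInvariantDensity f ρ ↔ IsStationaryDensity f (Measure.dirac 0) ρ := by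
  refine and_congr_right fun hρ => ?_
  have := hρ.isProbabilityMeasure
  have := Measure.isProbabilityMeasure_map (μ := densityMeasure ρ) hf.aemeasurable
  rw [measure_circle_eq_iff]
  refine forall_congr' fun ψ => ?_
  rw [integral_map hf.aemeasurable ψ.continuous.aestronglyMeasurable, hρ.integral_densityMeasure,
    hρ.integral_densityMeasure]
  simp [noiseAverage_dirac_zero]

/-- The law of the noise `ε ξ`, where `ξ` has density `g`. -/
def noiseLaw (g : ℝ → ℝ) (ε : ℝ) : Measure ℝ := (densityMeasure g).map fun t => ε * t

theorem IsProbDensity.isProbabilityMeasure_noiseLaw {g : ℝ → ℝ} (hg : IsProbDensity g) (ε : ℝ) :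
    IsProbabilityMeasure (noiseLaw g ε) :=
  have := hg.isProbabilityMeasure
  Measure.isProbabilityMeasure_map (measurable_const_mul ε).aemeasurable

theorem isNoisyInvariantDensity_iff {f : UnitAddCircle → UnitAddCircle} (hf : Continuous f)
    {g : ℝ → ℝ} (hg : IsProbDensity g) (ε : ℝ) [IsProbabilityMeasure (noiseLaw g ε)]
    (ρ : UnitAddCircle → ℝ) :
    IsNoisyInvariantDensity f g ε ρ ↔ IsStationaryDensity f (noiseLaw g ε) ρ := by
  refine and_congr_right fun hρ => ?_
  have := hρ.isProbabilityMeasure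
  have := hg.isProbabilityMeasure
  have hc := UnitAddCircle.continuous_coe
  have hm : Continuous fun p : UnitAddCircle × ℝ => f p.1 + ((ε * p.2 : ℝ) : UnitAddCircle) := by
    fun_prop
  have := Measure.isProbabilityMeasure_map
    (μ := (densityMeasure ρ).prod (densityMeasure g)) hm.aemeasurable
  rw [measure_circle_eq_iff]
  refine forall_congr' fun ψ => ?_
  have hψ := ψ.continuous
  rw [integral_map hm.aemeasurable hψ.aestronglyMeasurable, integral_prod
    (fun p : UnitAddCircle × ℝ => ψ (f p.1 + ((ε * p.2 : ℝ) : UnitAddCircle)))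
    (Integrable.of_bound (hψ.comp hm).aestronglyMeasurable ‖ψ‖
      (Filter.Eventually.of_forall fun _ => ψ.norm_coe_le_norm _)),
    hρ.integral_densityMeasure, hρ.integral_densityMeasure]
  have h : ∀ x, noiseAverage ((noiseLaw g ε).map Neg.neg) ψ (f x) =
      ∫ t, ψ (f x + ((ε * t : ℝ) : UnitAddCircle)) ∂densityMeasure g := fun x => by
    rw [noiseAverage_map_neg_apply, noiseLaw, integral_map (measurable_const_mul ε).aemeasurable
      (Continuous.aestronglyMeasurable (by fun_prop))]
  simp only [h]

theorem averagingOp_eq_noiseAverage {g : ℝ → ℝ} (hg : IsProbDensity g) {ε : ℝ} (hε : 0 < ε)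
    [IsProbabilityMeasure (noiseLaw g ε)] (u : C(UnitAddCircle, ℝ)) (x : UnitAddCircle) :
    averagingOp g ε u x = noiseAverage (noiseLaw g ε) u x := by
  have hc := UnitAddCircle.continuous_coe
  have hu := u.continuous
  rw [noiseAverage_apply, noiseLaw, integral_map (measurable_const_mul ε).aemeasurable
    (Continuous.aestronglyMeasurable (by fun_prop)), hg.integral_densityMeasure, averagingOp]
  have h := Measure.integral_comp_div
    (fun t : ℝ => g t * u (x - ((ε * t : ℝ) : UnitAddCircle))) ε
  simp only [mul_div_cancel₀ _ hε.ne', abs_of_pos hε, smul_eq_mul] at h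
  rw [h, inv_mul_cancel_left₀ hε.ne']

theorem abs_sub_sub_le_of_hasDerivAt {p p₁ p₂ p₃ : ℝ → ℝ} {M : ℝ}
    (h : ∀ x, HasDerivAt p (p₁ x) x ∧ HasDerivAt p₁ (p₂ x) x ∧ HasDerivAt p₂ (p₃ x) x)
    (hM : ∀ x, |p₃ x| ≤ M) (x y s : ℝ) :
    |(p (x - s) - p x + p₁ x * s) - (p (y - s) - p y + p₁ y * s)| ≤ M * s ^ 2 * |x - y| := by
  have h2 : ∀ x y, |p₂ x - p₂ y| ≤ M * |x - y| := fun x y => by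
    simpa only [Real.norm_eq_abs] using convex_univ.norm_image_sub_le_of_norm_hasDerivWithin_le
      (fun z _ => (h z).2.2.hasDerivWithinAt) (fun z _ => hM z) (Set.mem_univ y) (Set.mem_univ x)
  have hM0 : 0 ≤ M := (abs_nonneg _).trans (hM 0)
  have h1 : ∀ x, |p₁ (x - s) - p₁ x + p₂ x * s| ≤ M * s ^ 2 := fun x => by
    have hd : ∀ t, HasDerivAt (fun t => p₁ (x - t) + p₂ x * t) (-p₂ (x - t) + p₂ x) t := fun t => by
      refine (((h (x - t)).2.1.comp t ((hasDerivAt_id t).const_sub x)).add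
        ((hasDerivAt_id t).const_mul (p₂ x))).congr_deriv ?_
      ring
    have := (convex_Icc (-|s|) |s|).norm_image_sub_le_of_norm_hasDerivWithin_le (C := M * |s|)
      (fun t _ => (hd t).hasDerivWithinAt) (fun t ht => by
        rw [Real.norm_eq_abs, neg_add_eq_sub]
        refine (h2 _ _).trans (mul_le_mul_of_nonneg_left ?_ hM0)
        rw [sub_sub_cancel]
        exact abs_le.2 ht) (x := 0) (y := s) (by simp) (abs_le.1 le_rfl)
    rw [Real.norm_eq_abs, Real.norm_eq_abs, sub_zero, sub_zero, mul_assoc, ← sq, sq_abs] at this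
    convert this using 2
    ring
  have hd : ∀ x, HasDerivAt (fun x => p (x - s) - p x + p₁ x * s)
      (p₁ (x - s) - p₁ x + p₂ x * s) x := fun x =>
    (((h (x - s)).1.comp_sub_const x s).sub (h x).1).add ((h x).2.1.mul_const s)
  simpa only [Real.norm_eq_abs] using convex_univ.norm_image_sub_le_of_norm_hasDerivWithin_le
    (fun z _ => (hd z).hasDerivWithinAt) (fun z _ => h1 z) (Set.mem_univ y) (Set.mem_univ x)

/-- A quantitative form of `C^{2,1}` regularity: `q` plays the role of the derivative of `u`. -/
structure HasTaylorBound (u : C(UnitAddCircle, ℝ)) (q : ℝ → ℝ) (M : ℝ) : Prop where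
  lipschitz : ∀ x y : ℝ, |u x - u y| ≤ M * |x - y|
  lipschitz_deriv : ∀ x y, |q x - q y| ≤ M * |x - y|
  taylor : ∀ x y s : ℝ, |(u ((x - s : ℝ) : UnitAddCircle) - u x + q x * s) -
    (u ((y - s : ℝ) : UnitAddCircle) - u y + q y * s)| ≤ M * s ^ 2 * |x - y|

theorem exists_hasTaylorBound_of_tendsto {a₁ a₂ a₃ B : ℝ} (ha₁ : 0 ≤ a₁) (ha₂ : 0 ≤ a₂)
    (ha₃ : 0 ≤ a₃) {p : ℕ → C(UnitAddCircle, ℝ)} {u : C(UnitAddCircle, ℝ)}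
    (hp : ∀ n, DerivBounded a₁ a₂ a₃ (p n)) (hB : ∀ n x, p n x ≤ B)
    (hlim : ∀ x, Filter.Tendsto (fun n => p n x) Filter.atTop (nhds (u x))) :
    ∃ q M, 0 ≤ M ∧ HasTaylorBound u q M := by
  choose p0 p1 p2 p3 hd hb using hp
  obtain ⟨M, hM⟩ : ∃ M, M = max (a₁ * B) (max (a₂ * B) (a₃ * B)) := ⟨_, rfl⟩
  have h1 : ∀ (n : ℕ) (x : ℝ), |p1 n x| ≤ a₁ * B := fun n x =>
    (hb n x).1.trans (mul_le_mul_of_nonneg_left (hB n x) ha₁)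
  have h2 : ∀ (n : ℕ) (x : ℝ), |p2 n x| ≤ M := fun n x =>
    (hb n x).2.1.trans ((mul_le_mul_of_nonneg_left (hB n x) ha₂).trans
      (hM ▸ le_max_of_le_right (le_max_left _ _)))
  have h3 : ∀ (n : ℕ) (x : ℝ), |p3 n x| ≤ M := fun n x =>
    (hb n x).2.2.trans ((mul_le_mul_of_nonneg_left (hB n x) ha₃).trans
      (hM ▸ le_max_of_le_right (le_max_right _ _)))
  let l : Ultrafilter ℕ := Filter.hyperfilter ℕ
  have hl : (l : Filter ℕ) ≤ Filter.atTop := Nat.hyperfilter_le_atTop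
  have hq : ∀ x, ∃ z, Filter.Tendsto (fun n => p1 n x) l (nhds z) := fun x => by
    obtain ⟨z, -, hz⟩ := (isCompact_Icc (a := -(a₁ * B)) (b := a₁ * B)).ultrafilter_le_nhds
      (l.map fun n => p1 n x) (by
        rw [Filter.le_principal_iff, Ultrafilter.coe_map, Filter.mem_map]
        exact Filter.univ_mem' fun n => abs_le.1 (h1 n x))
    exact ⟨z, hz⟩
  choose q hq using hq
  refine ⟨q, M, (abs_nonneg _).trans (h2 0 0), fun x y => ?_, fun x y => ?_, fun x y s => ?_⟩
  · refine le_of_tendsto ((hlim x).sub (hlim y)).abs (Filter.Eventually.of_forall fun n => ?_)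
    simpa only [Real.norm_eq_abs] using convex_univ.norm_image_sub_le_of_norm_hasDerivWithin_le
      (fun z _ => (hd n z).1.hasDerivWithinAt)
      (fun z _ => (h1 n z).trans (hM ▸ le_max_left _ _)) (Set.mem_univ y) (Set.mem_univ x)
  · refine le_of_tendsto ((hq x).sub (hq y)).abs (Filter.Eventually.of_forall fun n => ?_)
    simpa only [Real.norm_eq_abs] using convex_univ.norm_image_sub_le_of_norm_hasDerivWithin_le
      (fun z _ => (hd n z).2.1.hasDerivWithinAt) (fun z _ => h2 n z) (Set.mem_univ y)
      (Set.mem_univ x)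
  · have hu := fun z : ℝ => (hlim z).mono_left hl
    refine le_of_tendsto ((((hu (x - s)).sub (hu x)).add ((hq x).mul_const s)).sub
      (((hu (y - s)).sub (hu y)).add ((hq y).mul_const s))).abs
      (Filter.Eventually.of_forall fun n => ?_)
    exact abs_sub_sub_le_of_hasDerivAt (hd n) (h3 n) x y s

theorem InverseLift.exists_hasTaylorBound {f : UnitAddCircle → UnitAddCircle} (Φ : InverseLift f)
    {u : C(UnitAddCircle, ℝ)}
    (hlim : Filter.Tendsto (fun n => (Φ.transfer ^ n) 1) Filter.atTop (nhds u)) :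
    ∃ q M, 0 ≤ M ∧ HasTaylorBound u q M := by
  obtain ⟨a₁, a₂, a₃, h₁, h₂, h₃, hmap⟩ := Φ.derivBounded_transfer
  obtain ⟨B, hB⟩ := (Metric.isBounded_range_of_tendsto _ hlim).exists_norm_le
  refine exists_hasTaylorBound_of_tendsto h₁ h₂ h₃ (p := fun n => (Φ.transfer ^ n) 1) (B := B)
    (fun n => ?_) (fun n x => ?_) fun x => ((continuous_eval_const x).tendsto u).comp hlim
  · induction n with
    | zero =>
      exact ⟨fun _ => zero_le_one, 0, 0, 0, fun x => ⟨hasDerivAt_const x _, hasDerivAt_const x _,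
        hasDerivAt_const x _⟩, fun x => by simp [h₁, h₂, h₃]⟩
    | succ n ih => rw [pow_succ']; exact hmap _ ih
  · exact (le_abs_self _).trans ((ContinuousMap.norm_coe_le_norm _ x).trans (hB _ ⟨n, rfl⟩))

/-- The integral of `u` against the character `fourier k`. -/
def mode (u : C(UnitAddCircle, ℝ)) (k : ℤ) : ℂ :=
  ∫ x : UnitAddCircle, fourier k x * (u x : ℂ)

/-- The defect `1 - ν̂(k)` of the Fourier transform of the noise. -/
def charDefect (ν : Measure ℝ) (k : ℤ) : ℂ :=
  ∫ s : ℝ, (1 - fourier k (s : UnitAddCircle)) ∂ν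

theorem norm_fourier_apply (k : ℤ) (x : UnitAddCircle) : ‖fourier k x‖ = 1 := by
  rw [fourier_apply]; exact Circle.norm_coe _

theorem mode_translate (u : C(UnitAddCircle, ℝ)) (k : ℤ) (t : UnitAddCircle) :
    ∫ x : UnitAddCircle, fourier k x * (u (x - t) : ℂ) = fourier k t * mode u k := by
  rw [mode, ← integral_const_mul, ← integral_add_right_eq_self _ t]
  refine integral_congr_ae (Filter.Eventually.of_forall fun x => ?_)
  simp only [add_sub_cancel_right, fourier_apply, smul_add, AddCircle.toCircle_add, Circle.coe_mul]
  ring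

theorem integrable_fourier_mul (u : C(UnitAddCircle, ℝ)) (k : ℤ) :
    Integrable fun x : UnitAddCircle => fourier k x * (u x : ℂ) :=
  Integrable.of_bound (Continuous.aestronglyMeasurable (by
    have := u.continuous
    have := (fourier (T := 1) k).continuous
    fun_prop)) ‖u‖
    (Filter.Eventually.of_forall fun x => by
      rw [norm_mul, norm_fourier_apply, one_mul, Complex.norm_real]
      exact u.norm_coe_le_norm x)

theorem mode_sub (u v : C(UnitAddCircle, ℝ)) (k : ℤ) : mode (u - v) k = mode u k - mode v k := by
  rw [mode, mode, mode, ← integral_sub (integrable_fourier_mul u k) (integrable_fourier_mul v k)]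
  simp only [ContinuousMap.sub_apply, Complex.ofReal_sub, mul_sub]

theorem norm_mode_le (u : C(UnitAddCircle, ℝ)) (k : ℤ) : ‖mode u k‖ ≤ ∫ x, |u x| := by
  refine (norm_integral_le_integral_norm _).trans_eq ?_
  simp only [norm_mul, norm_fourier_apply, one_mul, Complex.norm_real, Real.norm_eq_abs]

theorem integrable_fourier_coe (ν : Measure ℝ) [IsProbabilityMeasure ν] (k : ℤ) :
    Integrable (fun s : ℝ => fourier k (s : UnitAddCircle)) ν :=
  Integrable.of_bound ((fourier (T := 1) k).continuous.comp
    UnitAddCircle.continuous_coe).aestronglyMeasurable 1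
    (Filter.Eventually.of_forall fun s => (norm_fourier_apply k s).le)

theorem mode_noiseAverage (ν : Measure ℝ) [IsProbabilityMeasure ν] (u : C(UnitAddCircle, ℝ))
    (k : ℤ) : mode (noiseAverage ν u) k = (1 - charDefect ν k) * mode u k := by
  have hc := UnitAddCircle.continuous_coe
  have hu := u.continuous
  have hf := (fourier (T := 1) k).continuous
  have i1 : Integrable (Function.uncurry fun (x : UnitAddCircle) (s : ℝ) =>
      fourier k x * (u (x - (s : UnitAddCircle)) : ℂ)) (volume.prod ν) :=
    Integrable.of_bound (Continuous.aestronglyMeasurable (by unfold Function.uncurry; fun_prop))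
      ‖u‖ (Filter.Eventually.of_forall fun p => by
        simp only [Function.uncurry, norm_mul, norm_fourier_apply, one_mul, Complex.norm_real]
        exact u.norm_coe_le_norm _)
  rw [mode]
  simp only [noiseAverage_apply, ← integral_complex_ofReal, ← integral_const_mul]
  rw [integral_integral_swap i1]
  simp only [mode_translate]
  rw [integral_mul_const, charDefect, integral_sub (integrable_const _)
    (integrable_fourier_coe ν k)]
  simp

theorem norm_charDefect_mul_mode_le (ν : Measure ℝ) [IsProbabilityMeasure ν]
    (u : C(UnitAddCircle, ℝ)) (k : ℤ) :
    ‖charDefect ν k‖ * ‖mode u k‖ ≤ ∫ x, |(noiseAverage ν u - u) x| := by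
  have h := norm_mode_le (noiseAverage ν u - u) k
  rwa [mode_sub, mode_noiseAverage, show (1 - charDefect ν k) * mode u k - mode u k =
    -(charDefect ν k * mode u k) by ring, norm_neg, norm_mul] at h

theorem charDefect_re (ν : Measure ℝ) [IsProbabilityMeasure ν] (k : ℤ) :
    (charDefect ν k).re = ∫ s : ℝ, (1 - (fourier k (s : UnitAddCircle)).re) ∂ν := by
  have h := integral_re ((integrable_const (1:ℂ)).sub (integrable_fourier_coe ν k))
  simpa [charDefect] using h.symm

theorem charDefect_im (ν : Measure ℝ) [IsProbabilityMeasure ν] (k : ℤ) :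
    (charDefect ν k).im = -∫ s : ℝ, (fourier k (s : UnitAddCircle)).im ∂ν := by
  have h := integral_im ((integrable_const (1:ℂ)).sub (integrable_fourier_coe ν k))
  rw [← integral_neg]
  simpa [charDefect] using h.symm

theorem norm_one_sub_sq {w : ℂ} (hw : ‖w‖ = 1) : ‖1 - w‖ ^ 2 = 2 * (1 - w.re) := by
  have h : w.re * w.re + w.im * w.im = 1 := by
    rw [← Complex.normSq_apply, Complex.normSq_eq_norm_sq, hw, one_pow]
  rw [← Complex.normSq_eq_norm_sq, Complex.normSq_apply]
  simp only [Complex.sub_re, Complex.one_re, Complex.sub_im, Complex.one_im]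
  linear_combination h

theorem norm_charDefect_add_le (ν : Measure ℝ) [IsProbabilityMeasure ν] (j k : ℤ) :
    ‖charDefect ν (j + k)‖ ≤ 2 * ‖charDefect ν j‖ + 2 * ‖charDefect ν k‖ := by
  have hi : ∀ k, Integrable (fun s : ℝ => 1 - fourier k (s : UnitAddCircle)) ν := fun k =>
    (integrable_const _).sub (integrable_fourier_coe ν k)
  have hre : ∀ k, Integrable (fun s : ℝ => 1 - (fourier k (s : UnitAddCircle)).re) ν := fun k =>
    (integrable_const _).sub (integrable_fourier_coe ν k).re
  have heq : ∀ s : ℝ, 1 - fourier (j + k) (s : UnitAddCircle) =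
      (1 - fourier j (s : UnitAddCircle)) + (1 - fourier k (s : UnitAddCircle)) -
        (1 - fourier j (s : UnitAddCircle)) * (1 - fourier k (s : UnitAddCircle)) := fun s => by
    rw [fourier_add]; ring
  have hprod : ∀ s : ℝ, ‖(1 - fourier j (s : UnitAddCircle)) * (1 - fourier k (s : UnitAddCircle))‖
      ≤ (1 - (fourier j (s : UnitAddCircle)).re) + (1 - (fourier k (s : UnitAddCircle)).re) :=
    fun s => by
      rw [norm_mul]
      have h1 := norm_one_sub_sq (norm_fourier_apply j (s : UnitAddCircle))
      have h2 := norm_one_sub_sq (norm_fourier_apply k (s : UnitAddCircle))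
      nlinarith [sq_nonneg (‖1 - fourier j (s : UnitAddCircle)‖ -
        ‖1 - fourier k (s : UnitAddCircle)‖)]
  have hip : Integrable (fun s : ℝ => (1 - fourier j (s : UnitAddCircle)) *
      (1 - fourier k (s : UnitAddCircle))) ν :=
    ((hre j).add (hre k)).mono' ((hi j).aestronglyMeasurable.mul (hi k).aestronglyMeasurable)
      (Filter.Eventually.of_forall hprod)
  have hbound : ‖∫ s : ℝ, (1 - fourier j (s : UnitAddCircle)) *
      (1 - fourier k (s : UnitAddCircle)) ∂ν‖ ≤ (charDefect ν j).re + (charDefect ν k).re := by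
    rw [charDefect_re, charDefect_re, ← integral_add (hre j) (hre k)]
    exact norm_integral_le_of_norm_le ((hre j).add (hre k)) (Filter.Eventually.of_forall hprod)
  have hsplit : charDefect ν (j + k) = charDefect ν j + charDefect ν k -
      ∫ s : ℝ, (1 - fourier j (s : UnitAddCircle)) * (1 - fourier k (s : UnitAddCircle)) ∂ν := by
    rw [charDefect, charDefect, charDefect, ← integral_add (hi j) (hi k),
      ← integral_sub (f := fun s : ℝ => (1 - fourier j (s : UnitAddCircle)) +
        (1 - fourier k (s : UnitAddCircle))) ((hi j).add (hi k)) hip]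
    exact integral_congr_ae (Filter.Eventually.of_forall heq)
  rw [hsplit]
  have h1 := norm_sub_le (charDefect ν j + charDefect ν k) (∫ s : ℝ,
    (1 - fourier j (s : UnitAddCircle)) * (1 - fourier k (s : UnitAddCircle)) ∂ν)
  have h2 := norm_add_le (charDefect ν j) (charDefect ν k)
  have h3 := Complex.re_le_norm (charDefect ν j)
  have h4 := Complex.re_le_norm (charDefect ν k)
  linarith

theorem norm_charDefect_neg (ν : Measure ℝ) (k : ℤ) :
    ‖charDefect ν (-k)‖ = ‖charDefect ν k‖ := by
  have h : charDefect ν (-k) = (starRingEnd ℂ) (charDefect ν k) := by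
    rw [charDefect, charDefect, ← integral_conj]
    simp only [fourier_neg, map_sub, map_one]
  rw [h, RCLike.norm_conj]

theorem charDefect_zero (ν : Measure ℝ) : charDefect ν 0 = 0 := by simp [charDefect]

theorem eq_zero_of_mode_eq_zero {u : C(UnitAddCircle, ℝ)} (h : ∀ k, mode u k = 0) : u = 0 := by
  let v : C(UnitAddCircle, ℂ) := ⟨fun x => (u x : ℂ), by fun_prop⟩
  have hv : fourierCoeff v = 0 := by
    ext k
    rw [fourierCoeff, AddCircle.integral_haarAddCircle]
    have : ∫ x : UnitAddCircle, fourier (-k) x • v x = mode u (-k) := rfl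
    rw [this, h]; simp
  ext x
  have h1 := has_pointwise_sum_fourier_series_of_summable (f := v)
    (by rw [hv]; exact summable_zero) x
  simp only [hv, Pi.zero_apply, zero_smul] at h1
  have h2 : v x = 0 := h1.unique hasSum_zero
  exact Complex.ofReal_eq_zero.1 h2

theorem sub_eq_of_fourier_eq_one {u : C(UnitAddCircle, ℝ)} {t : UnitAddCircle}
    (h : ∀ k, mode u k ≠ 0 → fourier k t = 1) (x : UnitAddCircle) : u (x - t) = u x := by
  let w : C(UnitAddCircle, ℝ) := ⟨fun x => u (x - t), by fun_prop⟩
  have hw : w - u = 0 := eq_zero_of_mode_eq_zero fun k => by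
    have h1 : mode w k = fourier k t * mode u k := mode_translate u k t
    rw [mode_sub, h1]
    by_cases hk : mode u k = 0
    · rw [hk]; simp
    · rw [h k hk]; simp
  have := DFunLike.congr_fun hw x
  exact sub_eq_zero.1 this

theorem HasTaylorBound.abs_noiseAverage_sub_le {u : C(UnitAddCircle, ℝ)} {q : ℝ → ℝ} {M : ℝ}
    (hu : HasTaylorBound u q M) (hM : 0 ≤ M) {d : ℤ} (hd : d ≠ 0)
    (hper : ∀ k, mode u k ≠ 0 → d ∣ k) (ν : Measure ℝ) [IsProbabilityMeasure ν] (x y : ℝ) :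
    |(noiseAverage ν u - u) x - (noiseAverage ν u - u) y| ≤
      M * (Real.pi ^ 2 + 1) * ‖charDefect ν d‖ * |x - y| := by
  have hdR : (d : ℝ) ≠ 0 := by exact_mod_cast hd
  have hd1 : (1 : ℝ) ≤ |(d : ℝ)| := by exact_mod_cast Int.one_le_abs hd
  have hpi := Real.pi_pos
  have hred : ∀ s : ℝ, ∃ s' : ℝ, |2 * Real.pi * d * s'| ≤ Real.pi ∧
      fourier d (s : UnitAddCircle) = fourier d (s' : UnitAddCircle) ∧
      ∀ z : ℝ, u (z - (s : UnitAddCircle)) = u ((z - s' : ℝ) : UnitAddCircle) := fun s => by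
    obtain ⟨n, hn⟩ : ∃ n : ℤ, n = round (s * d) := ⟨_, rfl⟩
    have htriv : ∀ k, d ∣ k → fourier k ((n / d : ℝ) : UnitAddCircle) = (1 : ℂ) := fun k hk => by
      obtain ⟨m, rfl⟩ := hk
      rw [fourier_coe_apply]
      have : 2 * (Real.pi : ℂ) * Complex.I * ((d * m : ℤ) : ℂ) * ((n / d : ℝ) : ℂ) / ((1 : ℝ) : ℂ) =
          ((m * n : ℤ) : ℂ) * (2 * Real.pi * Complex.I) := by
        have : (d : ℂ) ≠ 0 := by exact_mod_cast hd
        push_cast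
        field_simp
      rw [this, Complex.exp_int_mul_two_pi_mul_I]
    refine ⟨s - n / d, ?_, ?_, fun z => ?_⟩
    · have h1 : 2 * Real.pi * d * (s - n / d) = 2 * Real.pi * (s * d - n) := by
        field_simp
      have h2 := abs_sub_round (s * (d : ℝ))
      rw [h1, abs_mul, abs_of_pos (by positivity : 0 < 2 * Real.pi), hn]
      nlinarith
    · have h1 : (s : UnitAddCircle) = ((s - n / d : ℝ) : UnitAddCircle) +
          ((n / d : ℝ) : UnitAddCircle) := by rw [← AddCircle.coe_add, sub_add_cancel]
      rw [h1, fourier_apply, smul_add, AddCircle.toCircle_add, Circle.coe_mul, ← fourier_apply,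
        ← fourier_apply, htriv d dvd_rfl, mul_one]
    · have h1 := sub_eq_of_fourier_eq_one (t := ((n / d : ℝ) : UnitAddCircle))
        (fun k hk => htriv k (hper k hk)) ((z - (s - n / d) : ℝ) : UnitAddCircle)
      rw [← h1, ← AddCircle.coe_sub, ← AddCircle.coe_sub]
      congr 2; ring
  have hpt : ∀ s : ℝ, |(u (x - (s : UnitAddCircle)) - u x - (u (y - (s : UnitAddCircle)) - u y)) +
      (q x - q y) / (2 * Real.pi * d) * (fourier d (s : UnitAddCircle)).im| ≤
      M * Real.pi ^ 2 * |x - y| * (1 - (fourier d (s : UnitAddCircle)).re) := fun s => by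
    obtain ⟨t, ht, hs, hz⟩ := hred s
    rw [hs, hz, hz, fourier_coe_apply]
    set θ := 2 * Real.pi * d * t with hθ
    have harg : 2 * (Real.pi : ℂ) * Complex.I * (d : ℂ) * (t : ℂ) / ((1 : ℝ) : ℂ) =
        (θ : ℂ) * Complex.I := by
      rw [hθ]; push_cast; ring
    rw [harg, Complex.exp_ofReal_mul_I_re, Complex.exp_ofReal_mul_I_im]
    have h1 := hu.taylor x y t
    have h2 := hu.lipschitz_deriv x y
    have h3 := Real.abs_sub_sin_le θ
    have h4 : Real.cos θ ≤ 1 - 2 / Real.pi ^ 2 * θ ^ 2 := Real.cos_le_one_sub_mul_cos_sq ht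
    have hθt : |θ| = 2 * Real.pi * |(d : ℝ)| * |t| := by
      rw [hθ, abs_mul, abs_mul, abs_of_pos (by positivity : 0 < 2 * Real.pi)]
    have hpid : 6 ≤ 2 * Real.pi * |(d : ℝ)| := by nlinarith [Real.pi_gt_three]
    have htθ : t ^ 2 ≤ θ ^ 2 := by
      rw [sq_le_sq, hθt]
      nlinarith [abs_nonneg t]
    have h5 : |Real.sin θ / (2 * Real.pi * d) - t| ≤ θ ^ 2 := by
      have e1 : Real.sin θ / (2 * Real.pi * d) - t = -(θ - Real.sin θ) / (2 * Real.pi * d) := by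
        rw [hθ]; field_simp; ring
      rw [e1, abs_div, abs_neg, abs_mul _ (d : ℝ), abs_of_pos (by positivity : 0 < 2 * Real.pi),
        div_le_iff₀ (by linarith)]
      have e2 : |θ| ^ 3 ≤ θ ^ 2 * Real.pi := by
        rw [pow_succ, sq_abs]
        exact mul_le_mul_of_nonneg_left ht (sq_nonneg _)
      nlinarith [Real.pi_le_four, sq_nonneg θ]
    have h6 : 2 * θ ^ 2 ≤ Real.pi ^ 2 * (1 - Real.cos θ) := by
      have e1 : Real.pi ^ 2 * (2 / Real.pi ^ 2 * θ ^ 2) = 2 * θ ^ 2 := by field_simp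
      rw [← e1]
      exact mul_le_mul_of_nonneg_left (by linarith) (by positivity)
    have hxy := abs_nonneg (x - y)
    have e0 : u ((x - t : ℝ) : UnitAddCircle) - u x - (u ((y - t : ℝ) : UnitAddCircle) - u y) +
        (q x - q y) / (2 * Real.pi * d) * Real.sin θ =
        (u ((x - t : ℝ) : UnitAddCircle) - u x + q x * t -
          (u ((y - t : ℝ) : UnitAddCircle) - u y + q y * t)) +
        (q x - q y) * (Real.sin θ / (2 * Real.pi * d) - t) := by ring
    rw [e0]
    calc _ ≤ M * t ^ 2 * |x - y| + (M * |x - y|) * θ ^ 2 := by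
          refine (abs_add_le _ _).trans (add_le_add h1 ?_)
          rw [abs_mul]
          gcongr
      _ ≤ M * θ ^ 2 * |x - y| + (M * |x - y|) * θ ^ 2 := by gcongr
      _ = M * |x - y| * (2 * θ ^ 2) := by ring
      _ ≤ M * |x - y| * (Real.pi ^ 2 * (1 - Real.cos θ)) := by gcongr
      _ = _ := by ring
  set c := (q x - q y) / (2 * Real.pi * d) with hc
  have hcb : |c| ≤ M * |x - y| := by
    rw [hc, abs_div, abs_mul _ (d : ℝ), abs_of_pos (by positivity : 0 < 2 * Real.pi)]
    refine (div_le_self (abs_nonneg _) ?_).trans (hu.lipschitz_deriv x y)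
    nlinarith [Real.pi_gt_three]
  have ix := (u.integrable_translate ν x).sub (integrable_const (u x))
  have iy := (u.integrable_translate ν y).sub (integrable_const (u y))
  have iim := (integrable_fourier_coe ν d).im.const_mul c
  have ire : Integrable (fun s : ℝ => 1 - (fourier d (s : UnitAddCircle)).re) ν :=
    (integrable_const _).sub (integrable_fourier_coe ν d).re
  have hval : ∀ z : ℝ, (noiseAverage ν u - u) z =
      ∫ s : ℝ, (u (z - (s : UnitAddCircle)) - u z) ∂ν := fun z => by
    rw [integral_sub (u.integrable_translate ν z) (integrable_const _)]
    simp [noiseAverage_apply]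
  have hint := norm_integral_le_of_norm_le
    (f := fun s : ℝ => (u (x - (s : UnitAddCircle)) - u x -
      (u (y - (s : UnitAddCircle)) - u y)) + c * (fourier d (s : UnitAddCircle)).im)
    (ire.const_mul (M * Real.pi ^ 2 * |x - y|))
    (Filter.Eventually.of_forall hpt)
  have hsplit : ∫ s : ℝ, ((u (x - (s : UnitAddCircle)) - u x - (u (y - (s : UnitAddCircle)) - u y)) +
      c * (fourier d (s : UnitAddCircle)).im) ∂ν =
      (noiseAverage ν u - u) x - (noiseAverage ν u - u) y - c * (charDefect ν d).im := by
    rw [hval, hval, charDefect_im, mul_neg, sub_neg_eq_add, ← integral_const_mul]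
    exact (integral_add (ix.sub iy) iim).trans (congrArg (· + _) (integral_sub ix iy))
  rw [hsplit, integral_const_mul, ← charDefect_re, Real.norm_eq_abs] at hint
  have h1 := Complex.abs_im_le_norm (charDefect ν d)
  have h2 := Complex.re_le_norm (charDefect ν d)
  have h3 : |c * (charDefect ν d).im| ≤ M * |x - y| * ‖charDefect ν d‖ := by
    rw [abs_mul]; gcongr
  calc |(noiseAverage ν u - u) x - (noiseAverage ν u - u) y|
      = |((noiseAverage ν u - u) x - (noiseAverage ν u - u) y - c * (charDefect ν d).im) +
          c * (charDefect ν d).im| := by rw [sub_add_cancel]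
    _ ≤ M * Real.pi ^ 2 * |x - y| * ‖charDefect ν d‖ + M * |x - y| * ‖charDefect ν d‖ :=
        (abs_add_le _ _).trans (add_le_add (hint.trans (by gcongr)) h3)
    _ = _ := by ring

theorem exists_abs_noiseAverage_sub_le {u : C(UnitAddCircle, ℝ)} {q : ℝ → ℝ} {M : ℝ}
    (hu : HasTaylorBound u q M) (hM : 0 ≤ M) :
    ∃ C : ℝ, 0 ≤ C ∧ ∀ (ν : Measure ℝ) [IsProbabilityMeasure ν] (x y : ℝ),
      |(noiseAverage ν u - u) x - (noiseAverage ν u - u) y| ≤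
        C * (∫ z, |(noiseAverage ν u - u) z|) * |x - y| := by
  let S : AddSubgroup ℤ :=
    { carrier := {k | ∃ C : ℝ, 0 ≤ C ∧ ∀ (ν : Measure ℝ) [IsProbabilityMeasure ν],
        ‖charDefect ν k‖ ≤ C * ∫ z, |(noiseAverage ν u - u) z|}
      zero_mem' := ⟨0, le_rfl, fun ν _ => by simp [charDefect_zero]⟩
      add_mem' := by
        rintro j k ⟨C, hC, hj⟩ ⟨C', hC', hk⟩
        refine ⟨2 * C + 2 * C', by positivity, fun ν _ => ?_⟩
        have := norm_charDefect_add_le ν j k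
        have := hj ν
        have := hk ν
        linarith
      neg_mem' := by
        rintro k ⟨C, hC, hk⟩
        exact ⟨C, hC, fun ν _ => by rw [norm_charDefect_neg]; exact hk ν⟩ }
  obtain ⟨d, hd⟩ := Int.subgroup_cyclic S
  have hdS : d ∈ S := by rw [hd]; exact AddSubgroup.subset_closure rfl
  have hdvd : ∀ k, mode u k ≠ 0 → d ∣ k := fun k hk => by
    have hkS : k ∈ S := ⟨‖mode u k‖⁻¹, by positivity, fun ν _ => by
      rw [inv_mul_eq_div, le_div_iff₀ (norm_pos_iff.2 hk)]
      exact norm_charDefect_mul_mode_le ν u k⟩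
    rw [hd, AddSubgroup.mem_closure_singleton] at hkS
    obtain ⟨n, hn⟩ := hkS
    exact ⟨n, by rw [← hn, smul_eq_mul, mul_comm]⟩
  by_cases hd0 : d = 0
  · refine ⟨0, le_rfl, fun ν _ x y => ?_⟩
    have hconst : noiseAverage ν u = u := by
      ext z
      rw [noiseAverage_apply]
      have : ∀ s : ℝ, u (z - (s : UnitAddCircle)) = u z := fun s =>
        sub_eq_of_fourier_eq_one (fun k hk => by
          have : k = 0 := zero_dvd_iff.1 (hd0 ▸ hdvd k hk)
          rw [this, fourier_zero]) z
      simp [this]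
    simp [hconst]
  · obtain ⟨C, hC, hCν⟩ := hdS
    refine ⟨M * (Real.pi ^ 2 + 1) * C, by positivity, fun ν _ x y => ?_⟩
    refine (hu.abs_noiseAverage_sub_le hM hd0 hdvd ν x y).trans ?_
    have := hCν ν
    rw [mul_assoc (M * (Real.pi ^ 2 + 1)) C]
    gcongr

namespace InverseLift

variable {f : UnitAddCircle → UnitAddCircle} (Φ : InverseLift f)

theorem noisyTransfer_dirac_zero : Φ.noisyTransfer (Measure.dirac 0) = Φ.transfer := by
  ext1 u
  rw [noisyTransfer_apply, noiseAverage_dirac_zero]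

theorem integral_abs_noiseAverage_sub_le {ν : Measure ℝ} [IsProbabilityMeasure ν]
    {u ρ : C(UnitAddCircle, ℝ)} (hu : Φ.transfer u = u) (hρ : Φ.noisyTransfer ν ρ = ρ) :
    ∫ x, |(noiseAverage ν u - u) x| ≤ 2 * ∫ x, |(ρ - u) x| := by
  let w : C(UnitAddCircle, ℝ) := ⟨fun x => |(ρ - u) x|, by fun_prop⟩
  have heq : noiseAverage ν u - u = (ρ - u) - Φ.noisyTransfer ν (ρ - u) := by
    rw [map_sub, hρ, noisyTransfer_apply, hu]; abel
  have hle : ∀ x, |(noiseAverage ν u - u) x| ≤ w x + Φ.noisyTransfer ν w x := fun x => by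
    rw [heq, ContinuousMap.sub_apply]
    exact (abs_sub _ _).trans
      (add_le_add le_rfl (Φ.abs_noisyTransfer_le ν (v := w) (fun _ => le_rfl) x))
  calc ∫ x, |(noiseAverage ν u - u) x| ≤ ∫ x, (w x + Φ.noisyTransfer ν w x) :=
        integral_mono (noiseAverage ν u - u).integrable_circle.abs
          (w.integrable_circle.add (Φ.noisyTransfer ν w).integrable_circle) hle
    _ = 2 * ∫ x, w x := by
        rw [integral_add w.integrable_circle (Φ.noisyTransfer ν w).integrable_circle,
          integral_noisyTransfer, two_mul]

theorem noisyTransfer_pow_eq_add_sum {ν : Measure ℝ} [IsProbabilityMeasure ν]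
    {u : C(UnitAddCircle, ℝ)} (hu : Φ.transfer u = u) (n : ℕ) :
    (Φ.noisyTransfer ν ^ n) u - u =
      ∑ k ∈ Finset.range n, (Φ.noisyTransfer ν ^ k) (noiseAverage ν u - u) := by
  have h : ∀ k, (Φ.noisyTransfer ν ^ k) (noiseAverage ν u - u) =
      (Φ.noisyTransfer ν ^ (k + 1)) u - (Φ.noisyTransfer ν ^ k) u := fun k => by
    rw [map_sub, pow_succ, mul_apply_eq_comp, noisyTransfer_apply, hu]
  simp only [h, Finset.sum_range_sub (fun k => (Φ.noisyTransfer ν ^ k) u)]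
  simp

theorem exists_integral_abs_sub_le {u : C(UnitAddCircle, ℝ)} (hu : Φ.transfer u = u)
    (hu1 : ∫ x, u x = 1)
    (hlim : Filter.Tendsto (fun n => (Φ.transfer ^ n) 1) Filter.atTop (nhds u)) :
    ∃ C : ℝ, 0 < C ∧ ∀ (ν : Measure ℝ) [IsProbabilityMeasure ν] (ρ : C(UnitAddCircle, ℝ)),
      Filter.Tendsto (fun n => (Φ.noisyTransfer ν ^ n) 1) Filter.atTop (nhds ρ) →
        ∫ x, |(ρ - u) x| ≤ C * ∫ x, |(noiseAverage ν u - u) x| := by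
  obtain ⟨C, r, hC, hr0, hr1, hdecay⟩ := Φ.exists_decay
  obtain ⟨q, M, hM, hq⟩ := Φ.exists_hasTaylorBound hlim
  obtain ⟨C', hC', hlip⟩ := exists_abs_noiseAverage_sub_le hq hM
  have hr : 0 < 1 - r := sub_pos.2 hr1
  refine ⟨C * C' * (1 - r)⁻¹ + 1, by positivity, fun ν _ ρ hρlim => ?_⟩
  replace hρlim := Φ.tendsto_pow_of_lipschitz hρlim hM hq.lipschitz
  rw [hu1, one_smul] at hρlim
  set h := noiseAverage ν u - u
  set I := ∫ x, |h x|
  have hI : 0 ≤ I := integral_nonneg fun _ => abs_nonneg _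
  have h0 : ∫ x, h x = 0 := by
    change ∫ x, (noiseAverage ν u x - u x) = 0
    rw [integral_sub (noiseAverage ν u).integrable_circle u.integrable_circle, integral_noiseAverage,
      sub_self]
  have hn : ∀ n, ‖(Φ.noisyTransfer ν ^ n) u - u‖ ≤ C * C' * (1 - r)⁻¹ * I := fun n => by
    rw [Φ.noisyTransfer_pow_eq_add_sum hu]
    calc _ ≤ ∑ k ∈ Finset.range n, C * (C' * I) * r ^ k :=
          norm_sum_le_of_le _ fun k _ => hdecay ν k h _ (by positivity) (hlip ν) h0
      _ = C * (C' * I) * ∑ k ∈ Finset.range n, r ^ k := by rw [Finset.mul_sum]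
      _ ≤ C * (C' * I) * (1 - r)⁻¹ := by
          gcongr
          rw [← tsum_geometric_of_lt_one hr0 hr1]
          exact (summable_geometric_of_lt_one hr0 hr1).sum_le_tsum _ fun k _ => pow_nonneg hr0 k
      _ = _ := by ring
  have hnorm : ‖ρ - u‖ ≤ C * C' * (1 - r)⁻¹ * I :=
    le_of_tendsto (hρlim.sub_const u).norm (Filter.Eventually.of_forall hn)
  calc ∫ x, |(ρ - u) x| ≤ ∫ _ : UnitAddCircle, ‖ρ - u‖ :=
        integral_mono (ρ - u).integrable_circle.abs (integrable_const _) (ρ - u).norm_coe_le_norm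
    _ = ‖ρ - u‖ := UnitAddCircle.integral_const _
    _ ≤ (C * C' * (1 - r)⁻¹ + 1) * I := by linarith

end InverseLift

theorem mainTheorem3 (f : UnitAddCircle → UnitAddCircle) (hf : IsSmoothExpanding f) :
    ∃ ρ₀ : UnitAddCircle → ℝ,
      IsInvariantDensity f ρ₀ ∧
      (∀ ρ : UnitAddCircle → ℝ, IsInvariantDensity f ρ → ρ =ᵐ[volume] ρ₀) ∧
      ∃ N : ℕ, 1 ≤ N ∧
        ∀ g : ℝ → ℝ, IsProbDensity g →
          ∃ ρ : ℝ → UnitAddCircle → ℝ,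
            (∀ ε : ℝ, 0 < ε →
              IsNoisyInvariantDensity (f^[N]) g ε (ρ ε) ∧
              ∀ ρ' : UnitAddCircle → ℝ,
                IsNoisyInvariantDensity (f^[N]) g ε ρ' → ρ' =ᵐ[volume] ρ ε) ∧
            ∃ c₁ c₂ : ℝ, 0 < c₁ ∧ 0 < c₂ ∧ ∀ ε : ℝ, 0 < ε →
              c₁ * oneNorm (fun x => ρ ε x - ρ₀ x) ≤
                  oneNorm (fun x => averagingOp g ε ρ₀ x - ρ₀ x) ∧
              oneNorm (fun x => averagingOp g ε ρ₀ x - ρ₀ x) ≤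
                  c₂ * oneNorm (fun x => ρ ε x - ρ₀ x) := by
  obtain ⟨Φ⟩ := hf.nonempty_inverseLift
  have hfc := Φ.continuous_map
  obtain ⟨u, hu0, hu1, hufix, hulim⟩ := Φ.exists_fixed (Measure.dirac 0)
  have hust := Φ.isStationaryDensity_of_fixed hu0 hu1 hufix
  refine ⟨u, (isInvariantDensity_iff hfc _).2 hust, fun ρ hρ =>
    ae_eq_of_integral_mul_eq hρ.1 hust.1 fun ψ =>
      Φ.integral_eq_of_isStationaryDensity hulim ((isInvariantDensity_iff hfc _).1 hρ) ψ,
    1, le_rfl, fun g hg => ?_⟩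
  rw [Φ.noisyTransfer_dirac_zero] at hufix hulim
  have := fun ε => hg.isProbabilityMeasure_noiseLaw ε
  choose ρ hρ0 hρ1 hρfix hρlim using fun ε => Φ.exists_fixed (noiseLaw g ε)
  have hst := fun ε => Φ.isStationaryDensity_of_fixed (hρ0 ε) (hρ1 ε) (hρfix ε)
  obtain ⟨C, hC, hbound⟩ := Φ.exists_integral_abs_sub_le hufix hu1 hulim
  refine ⟨fun ε => ρ ε, fun ε _ => ?_, C⁻¹, 2, inv_pos.2 hC, two_pos, fun ε hε => ?_⟩
  · rw [Function.iterate_one]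
    exact ⟨(isNoisyInvariantDensity_iff hfc hg ε _).2 (hst ε), fun ρ' hρ' =>
      ae_eq_of_integral_mul_eq hρ'.1 (hst ε).1 fun ψ =>
        Φ.integral_eq_of_isStationaryDensity (hρlim ε)
          ((isNoisyInvariantDensity_iff hfc hg ε _).1 hρ') ψ⟩
  · simp only [oneNorm, averagingOp_eq_noiseAverage hg hε]
    exact ⟨(inv_mul_le_iff₀ hC).2 (hbound (noiseLaw g ε) (ρ ε) (hρlim ε)),
      Φ.integral_abs_noiseAverage_sub_le hufix (hρfix ε)⟩

end
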